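/- Let $\mathcal k$ be a perfect field of characteristic $p>0$, let $\Sigma\subseteq\mathbb R^d$ be a strongly convex rational polyhedral cone, and let $R=\mathcal k[\Sigma^\vee\cap\mathbb Z^d]$ be the associated (normal affine) toric ring, where $\Sigma^\vee=\{m\in\mathbb R^d\mid \langle m,x\rangle\ge 0 \text{ for all } x\in\Sigma\}$; thus $R$ is contained in $\mathcal T=\mathcal k[x_1^{\pm1},\dots,x_d^{\pm1}]$. For each ray (one-dimensional face) $\rho$ of $\Sigma$ let $v_\rho$ be the shortest nonzero vector of $\mathbb Z^d\cap\rho$, and let $P^\circ_{-K_X}$ be the interior of the anticanonical polytope $$P_{-K_X}=\{u\in\mathbb R^d\mid \langle u,v_\rho\rangle\ge -1\text{ for all rays }\rho\text{ of }\Sigma\}$$ of $X=\operatorname{Spec}R$. Let $n,e>0$ be integers and $q=p^e$. Let $\mathcal D^{(n)}_e(R)$ be the set of those $\varphi\in\operatorname{Hom}_R(R^{1/q},R)$ for which there is an $R^{\otimes n}$-linear map $\widehat\varphi:(R^{\otimes n})^{1/q}\to R^{\otimes n}$ with $\Delta_n\circ\widehat\varphi=\varphi\circ\Delta_n^{1/q}$,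 where tensor products are over $\mathcal k$, $\Delta_n:R^{\otimes n}\to R$ is the multiplication map and $\Delta_n^{1/q}(z^{1/q})=\Delta_n(z)^{1/q}$. For $a\in\frac1q\mathbb Z^d$ let $\pi_a:\mathcal T^{1/q}\to\mathcal T$ be the $\mathcal T$-linear map with $\pi_a(x^u)=x^{a+u}$ if $a+u\in\mathbb Z^d$ and $\pi_a(x^u)=0$ otherwise, for all $u\in\frac1q\mathbb Z^d$; if $\pi_a(R^{1/q})\subseteq R$, its restriction to $R^{1/q}$ is an element of $\operatorname{Hom}_R(R^{1/q},R)$, again denoted $\pi_a$. Then $\mathcal D^{(n)}_e(R)$ is the $\mathcal k$-linear span in $\operatorname{Hom}_R(R^{1/q},R)$ of those maps $\pi_a\in\operatorname{Hom}_R(R^{1/q},R)$, $a\in\frac1q\mathbb Z^d$, that satisfy the following: for all $u_1,\dots,u_{n-1}\in\frac1q\mathbb Z^d$ there exist $v_i\in u_i+\mathbb Z^d$, $1\le i\le n-1$, such that $v_i\in P^\circ_{-K_X}$ for all $i$ and $\sum_{i=1}^{n-1}v_i\in a-P^\circ_{-K_X}$. (For $n=1$ the condition reads $a\in P^\circ_{-K_X}$.)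 -/

import Mathlib

open scoped TensorProduct

namespace ToricDiag

/-! ### Roots `A^{1/q}`, `q = p ^ e`, and `p^{-e}`-linear maps -/

/-- The ring `A^{1/q}` of `q`-th roots, `q = p ^ e`, of elements of a ring `A` of characteristic
`p`. Every element is `a^{1/q}` for a unique `a : A` (see `root`); as a ring it is a copy of `A`,
and `A` acts on it by `r • a^{1/q} = (r ^ q * a)^{1/q}`. -/
def FrobRoot (_p _e : ℕ) (A : Type*) : Type _ := A

instance (p e : ℕ) (A : Type*) [CommRing A] : CommRing (FrobRoot p e A) :=
  inferInstanceAs (CommRing A)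

/-- The bijection `a ↦ a^{1/q}` from `A` to `A^{1/q}`, a ring isomorphism. -/
def root (p e : ℕ) (A : Type*) [CommRing A] : A ≃+* FrobRoot p e A := RingEquiv.refl A

/-- `A^{1/q}` is an `A`-algebra through `r ↦ (r ^ q)^{1/q}`. -/
instance (p e : ℕ) (A : Type*) [CommRing A] [ExpChar A p] : Algebra A (FrobRoot p e A) :=
  ((root p e A).toRingHom.comp (iterateFrobenius A p e)).toAlgebra

theorem smul_root (p e : ℕ) {A : Type*} [CommRing A] [ExpChar A p] (r a : A) :
    r • root p e A a = root p e A (r ^ (p ^ e) * a) := by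
  rw [Algebra.smul_def, map_mul]
  rfl

/-- The ring map `f^{1/q} : A^{1/q} → B^{1/q}`, `a^{1/q} ↦ f(a)^{1/q}`. -/
def FrobRoot.map (p e : ℕ) {A B : Type*} [CommRing A] [CommRing B] (f : A →+* B) :
    FrobRoot p e A →+* FrobRoot p e B :=
  ((root p e B).toRingHom.comp f).comp (root p e A).symm.toRingHom

/-- `Hom_A(A^{1/q}, A)`, the degree `e` part of the full Cartier algebra of `A`. -/
abbrev Cartier (p e : ℕ) (A : Type*) [CommRing A] [ExpChar A p] : Type _ :=
  FrobRoot p e A →ₗ[A] A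

/-! ### Diagonal Cartier algebras -/

/-- The `n`-fold tensor power of `R` over `k`. -/
abbrev TensorPow (k : Type*) (n : ℕ) (R : Type*) [Field k] [CommRing R] [Algebra k R] : Type _ :=
  ⨂[k] _i : Fin n, R

/-- The multiplication map `Δ_n : R^{⊗ n} → R`, `r₁ ⊗ ⋯ ⊗ rₙ ↦ r₁ ⋯ rₙ`. -/
noncomputable def diagMap (k : Type*) (n : ℕ) (R : Type*) [Field k] [CommRing R] [Algebra k R] :
    TensorPow k n R →ₐ[k] R :=
  PiTensorProduct.liftAlgHom (MultilinearMap.mkPiAlgebra k (Fin n) R) (by simp)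
    (fun x y => by simp [Finset.prod_mul_distrib])

theorem diagMap_tprod (k : Type*) (n : ℕ) (R : Type*) [Field k] [CommRing R] [Algebra k R]
    (x : Fin n → R) : diagMap k n R (PiTensorProduct.tprod k x) = ∏ i, x i := by
  have h : diagMap k n R (PiTensorProduct.tprod k x) =
      PiTensorProduct.lift (MultilinearMap.mkPiAlgebra k (Fin n) R)
        (PiTensorProduct.tprod k x) := rfl
  rw [h]
  simp

instance (k : Type*) (n : ℕ) (R : Type*) [Field k] [CommRing R] [Algebra k R] [Nontrivial R] :
    Nontrivial (TensorPow k n R) :=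
  (diagMap k n R).toRingHom.domain_nontrivial

instance (p : ℕ) (k : Type*) (n : ℕ) (R : Type*) [Field k] [CommRing R] [Algebra k R]
    [Nontrivial R] [ExpChar k p] : ExpChar (TensorPow k n R) p :=
  expChar_of_injective_algebraMap (algebraMap k (TensorPow k n R)).injective p

/-- `𝓓^{(n)}_e(R)`: the maps `φ : R^{1/q} → R` that have a lifting
`φ' : (R^{⊗ n})^{1/q} → R^{⊗ n}`, linear over `R^{⊗ n}`, with `Δ_n ∘ φ' = φ ∘ Δ_n^{1/q}`. -/
noncomputable def diagCartier (k : Type*) (p n e : ℕ) (R : Type*) [Field k] [ExpChar k p]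
    [CommRing R] [Algebra k R] [Nontrivial R] [ExpChar R p] :
    Submodule k (Cartier p e R) where
  carrier := {φ | ∃ φ' : Cartier p e (TensorPow k n R), ∀ z : FrobRoot p e (TensorPow k n R),
    diagMap k n R (φ' z) = φ (FrobRoot.map p e (diagMap k n R).toRingHom z)}
  zero_mem' := ⟨0, fun z => by simp⟩
  add_mem' := by
    rintro φ ψ ⟨φ', h⟩ ⟨ψ', h'⟩
    exact ⟨φ' + ψ', fun z => by simp only [LinearMap.add_apply, map_add, h, h']⟩
  smul_mem' := by
    rintro c φ ⟨φ', h⟩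
    exact ⟨c • φ', fun z => by simp only [LinearMap.smul_apply, map_smul, h]⟩

/-! ### Cones and toric rings -/

/-- An integral vector, seen in `ℝ^d`. -/
def toReal {d : ℕ} (m : Fin d → ℤ) : Fin d → ℝ := fun i => (m i : ℝ)

/-- `σ` is generated by finitely many integral vectors. -/
def IsRationalPolyhedral {d : ℕ} (σ : PointedCone ℝ (Fin d → ℝ)) : Prop :=
  ∃ s : Finset (Fin d → ℤ), σ = PointedCone.hull ℝ (toReal '' (s : Set (Fin d → ℤ)))

/-- `σ` contains no line. -/
def IsStronglyConvex {d : ℕ} (σ : PointedCone ℝ (Fin d → ℝ)) : Prop :=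
  ∀ x ∈ σ, -x ∈ σ → x = 0

/-- `ρ` is a ray of `σ`, i.e. a one-dimensional face. -/
def IsRayOf {d : ℕ} (ρ σ : PointedCone ℝ (Fin d → ℝ)) : Prop :=
  ρ.IsFaceOf σ ∧ Module.finrank ℝ (Submodule.span ℝ (ρ : Set (Fin d → ℝ))) = 1

/-- `v` is a shortest nonzero vector of `ℤ^d ∩ ρ`. -/
def IsPrimitiveGenerator {d : ℕ} (v : Fin d → ℤ) (ρ : PointedCone ℝ (Fin d → ℝ)) : Prop :=
  toReal v ∈ ρ ∧ v ≠ 0 ∧ ∀ w : Fin d → ℤ, toReal w ∈ ρ → w ≠ 0 → v ⬝ᵥ v ≤ w ⬝ᵥ w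

/-- The polytope `P_{-K_X} = {u | ⟨u, v_ρ⟩ ≥ -1 for all rays ρ of σ}`. -/
def anticanonicalPolytope {d : ℕ} (σ : PointedCone ℝ (Fin d → ℝ)) : Set (Fin d → ℝ) :=
  {u | ∀ (ρ : PointedCone ℝ (Fin d → ℝ)) (v : Fin d → ℤ),
    IsRayOf ρ σ → IsPrimitiveGenerator v ρ → -1 ≤ u ⬝ᵥ toReal v}

/-- The monoid `σ^∨ ∩ ℤ^d` of lattice points of the dual cone. -/
def dualMonoid {d : ℕ} (σ : PointedCone ℝ (Fin d → ℝ)) : AddSubmonoid (Fin d → ℤ) where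
  carrier := {m | ∀ x ∈ σ, 0 ≤ toReal m ⬝ᵥ x}
  zero_mem' := fun x _ => by simp [toReal, dotProduct]
  add_mem' := fun {a b} ha hb x hx => by
    have h : toReal (a + b) = toReal a + toReal b := by ext i; simp [toReal]
    rw [h, add_dotProduct]
    exact add_nonneg (ha x hx) (hb x hx)

/-- The toric ring `k[σ^∨ ∩ ℤ^d]`. -/
abbrev ToricRing (k : Type*) [Field k] {d : ℕ} (σ : PointedCone ℝ (Fin d → ℝ)) : Type _ :=
  AddMonoidAlgebra k (dualMonoid σ)

/-- The coordinate ring `k[x₁^±, …, x_d^±]` of the torus; the monomial `c x^m` is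
`AddMonoidAlgebra.single m c`. -/
abbrev TorusRing (k : Type*) [Field k] (d : ℕ) : Type _ :=
  AddMonoidAlgebra k (Fin d → ℤ)

instance (k M : Type*) [Field k] [AddCommMonoid M] (p : ℕ) [ExpChar k p] :
    ExpChar (AddMonoidAlgebra k M) p :=
  expChar_of_injective_algebraMap (algebraMap k (AddMonoidAlgebra k M)).injective p

/-- The inclusion of the toric ring in the Laurent polynomial ring. -/
noncomputable def toricIncl (k : Type*) [Field k] {d : ℕ} (σ : PointedCone ℝ (Fin d → ℝ)) :
    ToricRing k σ →+* TorusRing k d :=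
  AddMonoidAlgebra.mapDomainRingHom k (dualMonoid σ).subtype

/-! ### The maps `π_a` -/

/-- The vector `b / q` of `(1/q) ℤ^d`, where `q = p ^ e`. -/
noncomputable def frac {d : ℕ} (p e : ℕ) (b : Fin d → ℤ) : Fin d → ℝ :=
  fun i => (b i : ℝ) / (p : ℝ) ^ e

theorem shift_injective {d : ℕ} (p e : ℕ) [NeZero p] (b : Fin d → ℤ) :
    Function.Injective (fun w : Fin d → ℤ => (p ^ e) • w - b) := by
  intro w w' h
  have h2 : (p ^ e) • w = (p ^ e) • w' := sub_left_injective h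
  funext i
  have h3 := congrFun h2 i
  have hp : ((p : ℤ) ^ e) ≠ 0 := pow_ne_zero _ (by exact_mod_cast NeZero.ne p)
  simp only [Pi.smul_apply, nsmul_eq_mul, Nat.cast_pow] at h3
  exact mul_left_cancel₀ hp h3

/-- The additive map on Laurent polynomials underlying `π_a`, `a = b / q`: the coefficient of its
value on `f` at `x^w` is the `q`-th root of the coefficient of `f` at `x^{q (w - a)}`. -/
noncomputable def piFun (k : Type*) [Field k] (p e : ℕ) [ExpChar k p] [PerfectRing k p] [NeZero p]
    {d : ℕ} (b : Fin d → ℤ) : TorusRing k d →+ TorusRing k d where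
  toFun f := .ofCoeff
    ((f.coeff.comapDomain (fun w : Fin d → ℤ => (p ^ e) • w - b)
      (shift_injective p e b).injOn).mapRange (iterateFrobeniusEquiv k p e).symm (map_zero _))
  map_zero' := by ext; simp
  map_add' f g := by ext; simp

section
variable (k : Type*) [Field k] (p e : ℕ) [ExpChar k p] [PerfectRing k p] [NeZero p] {d : ℕ}

theorem piFun_coeff (b : Fin d → ℤ) (f : TorusRing k d) (w : Fin d → ℤ) :
    (piFun k p e b f).coeff w = (iterateFrobeniusEquiv k p e).symm (f.coeff ((p ^ e) • w - b)) :=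
  rfl

theorem piFun_single (b w : Fin d → ℤ) (c : k) :
    piFun k p e b (.single ((p ^ e) • w - b) c) =
      .single w ((iterateFrobeniusEquiv k p e).symm c) := by
  ext w'
  rw [piFun_coeff]
  by_cases h : w = w'
  · subst h; simp
  · have h' : (p ^ e) • w - b ≠ (p ^ e) • w' - b := fun h2 => h (shift_injective p e b h2)
    simp only [AddMonoidAlgebra.coeff_single, Finsupp.single_apply, h, h', if_false, map_zero]

theorem piFun_single_of_ne (b m : Fin d → ℤ) (c : k) (h : ∀ w, m ≠ (p ^ e) • w - b) :
    piFun k p e b (.single m c) = 0 := by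
  ext w
  rw [piFun_coeff]
  simp only [AddMonoidAlgebra.coeff_single, Finsupp.single_apply, h w, if_false, map_zero]
  rfl

theorem piFun_pow_mul (b : Fin d → ℤ) (r f : TorusRing k d) :
    piFun k p e b (r ^ (p ^ e) * f) = r * piFun k p e b f := by
  induction r using AddMonoidAlgebra.induction_linear with
  | zero =>
    have : p ^ e ≠ 0 := pow_ne_zero _ (NeZero.ne p)
    rw [zero_pow this, zero_mul, zero_mul, map_zero]
  | add r s hr hs => rw [add_pow_expChar_pow, add_mul, map_add, hr, hs, add_mul]
  | single u s =>
    induction f using AddMonoidAlgebra.induction_linear with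
    | zero => simp
    | add f g hf hg => rw [mul_add, map_add, hf, hg, map_add, mul_add]
    | single m c =>
      rw [AddMonoidAlgebra.single_pow, AddMonoidAlgebra.single_mul_single]
      by_cases h : ∃ w, m = (p ^ e) • w - b
      · obtain ⟨w, rfl⟩ := h
        have h1 : (p ^ e) • u + ((p ^ e) • w - b) = (p ^ e) • (u + w) - b := by
          rw [smul_add]; abel
        rw [h1, piFun_single, piFun_single, AddMonoidAlgebra.single_mul_single, map_mul]
        congr 2
        rw [← iterateFrobenius_def, ← coe_iterateFrobeniusEquiv, RingEquiv.symm_apply_apply]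
      · push Not at h
        rw [piFun_single_of_ne k p e b m c h, piFun_single_of_ne, mul_zero]
        intro w hw
        refine h (w - u) ?_
        rw [smul_sub, eq_sub_of_add_eq' hw]
        abel

/-- The map `π_a : 𝓣^{1/q} → 𝓣`, `a = b / q`, where `𝓣 = k[x₁^±, …, x_d^±]`. -/
noncomputable def piMap (b : Fin d → ℤ) : Cartier p e (TorusRing k d) where
  toFun x := piFun k p e b ((root p e (TorusRing k d)).symm x)
  map_add' x y := by rw [map_add, map_add]
  map_smul' r x := by
    obtain ⟨f, rfl⟩ := (root p e (TorusRing k d)).surjective x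
    rw [smul_root, RingEquiv.symm_apply_apply, RingEquiv.symm_apply_apply, piFun_pow_mul]
    rfl

/-- `π_a(x^u) = x^{a+u}` if `a + u` is an integral vector `w`. -/
theorem piMap_monomial (b m w : Fin d → ℤ) (h : frac p e b + frac p e m = toReal w) :
    piMap k p e b (root p e (TorusRing k d) (.single m 1)) = .single w 1 := by
  have hp : ((p : ℝ) ^ e) ≠ 0 := pow_ne_zero _ (by exact_mod_cast NeZero.ne p)
  have hm : m = (p ^ e) • w - b := by
    funext i
    have h1 := congrFun h i
    simp only [frac, toReal, Pi.add_apply] at h1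
    field_simp at h1
    have h3 : ((p ^ e) • w - b) i = (p : ℤ) ^ e * w i - b i := by
      rw [Pi.sub_apply, Pi.smul_apply, nsmul_eq_mul, Nat.cast_pow]
    rw [h3]
    have h2 : b i + m i = (p : ℤ) ^ e * w i := by
      exact_mod_cast h1
    linarith
  subst hm
  change piFun k p e b _ = _
  rw [RingEquiv.symm_apply_apply, piFun_single, map_one]

/-- `π_a(x^u) = 0` if `a + u` is not an integral vector. -/
theorem piMap_monomial_of_ne (b m : Fin d → ℤ)
    (h : ∀ w, frac p e b + frac p e m ≠ toReal w) :
    piMap k p e b (root p e (TorusRing k d) (.single m 1)) = 0 := by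
  have hp : ((p : ℝ) ^ e) ≠ 0 := pow_ne_zero _ (by exact_mod_cast NeZero.ne p)
  change piFun k p e b _ = _
  rw [RingEquiv.symm_apply_apply, piFun_single_of_ne]
  rintro w rfl
  refine h w ?_
  funext i
  have h3 : ((p ^ e) • w - b) i = (p : ℤ) ^ e * w i - b i := by
    rw [Pi.sub_apply, Pi.smul_apply, nsmul_eq_mul, Nat.cast_pow]
  simp only [frac, toReal, Pi.add_apply, h3]
  push_cast
  field_simp
  ring

end

/-- `φ ∈ Hom_R(R^{1/q}, R)` is the restriction of `ψ ∈ Hom_𝓣(𝓣^{1/q}, 𝓣)` to the toric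
ring `R ⊆ 𝓣`. -/
def IsRestriction (k : Type*) [Field k] (p e : ℕ) [ExpChar k p] {d : ℕ}
    (σ : PointedCone ℝ (Fin d → ℝ)) (φ : Cartier p e (ToricRing k σ))
    (ψ : Cartier p e (TorusRing k d)) : Prop :=
  ∀ x : FrobRoot p e (ToricRing k σ),
    toricIncl k σ (φ x) = ψ (FrobRoot.map p e (toricIncl k σ) x)

/-- For all `u₁, …, u_{n-1} ∈ (1/q) ℤ^d` there are `v_i ∈ u_i + ℤ^d` in `P°_{-K_X}` with
`∑ v_i ∈ a - P°_{-K_X}`. -/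
def DiagCondition (p n e : ℕ) {d : ℕ} (σ : PointedCone ℝ (Fin d → ℝ)) (a : Fin d → ℝ) : Prop :=
  ∀ u : Fin (n - 1) → Fin d → ℤ, ∃ v : Fin (n - 1) → Fin d → ℝ,
    (∀ i, ∃ m : Fin d → ℤ, v i = frac p e (u i) + toReal m) ∧
    (∀ i, v i ∈ interior (anticanonicalPolytope σ)) ∧
    ∃ w ∈ interior (anticanonicalPolytope σ), ∑ i, v i = a - w

end ToricDiag

/-!
A Cartier map `φ` on an algebra over a perfect field with a multiplicative basis of monomials is
determined by its values on the roots of monomials, and those values are subject only to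
compatibility with multiplication by monomials (`exists_cartier_of_basis`,
`cartier_ext_of_basis`). This applies to the toric ring `R` and, with pure tensors of monomials as
basis, to `R^{⊗ n}`.

On `R` the coefficient of `x ^ w` in `φ((x ^ u) ^ {1/q})` depends only on `b = q w - u`, it vanishes
for all but finitely many `b`, and if it is nonzero then `π_a`, `a = b / q`, preserves `R`; so `φ` is
a linear combination of these `π_a` (`mem_span_isRestriction`). Convex geometry enters through
`frac_mem_interior_iff`: `π_a` preserves `R` exactly when `a` is an interior point of the
anticanonical polytope. This rests on two facts about a strongly convex rational cone: it is
generated by its rays, and each ray is cut out by an integral functional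
(`exists_integral_exposing`).

If `φ` has a lifting `φ'` to `R^{⊗ n}`, evaluate `φ'` at the root of `x ^ {W₁} ⊗ ⋯ ⊗ x ^ {Wₙ}`. A
degree `b` of `φ` with `b + ∑ Wᵢ` divisible by `q` must come from a term
`x ^ {V₁} ⊗ ⋯ ⊗ x ^ {Vₙ}` of the value, and `b = ∑ (q Vᵢ - Wᵢ)` is a splitting of `b` with prescribed
residues; linearity of `φ'` in each tensor factor forces every `(q Vᵢ - Wᵢ) / q` into the interior
of the polytope (`exists_split_of_mem_degreeSupport`). Conversely, a choice of such a splitting for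
each system of residues defines a lifting of `π_a` on pure tensors of monomials
(`mem_diagCartier_of_split`).
-/

namespace ToricDiag

/-! ### Integral functionals on rational cones -/

section
variable {d : ℕ}

theorem toReal_dotProduct (m v : Fin d → ℤ) : toReal m ⬝ᵥ toReal v = ((m ⬝ᵥ v : ℤ) : ℝ) := by
  simp [toReal, dotProduct]

theorem toReal_injective : Function.Injective (toReal : (Fin d → ℤ) → Fin d → ℝ) := by
  intro a b h
  funext i
  have h1 : (a i : ℝ) = b i := congrFun h i
  exact_mod_cast h1

theorem toReal_zero : toReal (0 : Fin d → ℤ) = 0 := by ext i; simp [toReal]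

theorem toReal_zsmul (c : ℤ) (a : Fin d → ℤ) : toReal (c • a) = (c : ℝ) • toReal a := by
  ext i; simp [toReal]

theorem dotProduct_nonneg_of_mem_hull {S : Set (Fin d → ℝ)} {y : Fin d → ℝ}
    (h : ∀ s ∈ S, 0 ≤ y ⬝ᵥ s) {x : Fin d → ℝ} (hx : x ∈ PointedCone.hull ℝ S) : 0 ≤ y ⬝ᵥ x := by
  induction hx using Submodule.span_induction with
  | mem x hx => exact h x hx
  | zero => simp
  | add x z _ _ hx hz => rw [dotProduct_add]; exact add_nonneg hx hz
  | smul a x _ hx =>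
    change 0 ≤ y ⬝ᵥ ((a : ℝ) • x)
    rw [dotProduct_smul]
    exact mul_nonneg a.2 hx

theorem mem_dualMonoid_hull {S : Finset (Fin d → ℤ)} {σ : PointedCone ℝ (Fin d → ℝ)}
    (hS : σ = PointedCone.hull ℝ (toReal '' (S : Set (Fin d → ℤ)))) {m : Fin d → ℤ} :
    m ∈ dualMonoid σ ↔ ∀ s ∈ S, 0 ≤ m ⬝ᵥ s := by
  constructor
  · intro h s hs
    have h1 := h (toReal s) (hS ▸ PointedCone.subset_hull ⟨s, hs, rfl⟩)
    rw [toReal_dotProduct] at h1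
    exact_mod_cast h1
  · intro h x hx
    rw [hS] at hx
    refine dotProduct_nonneg_of_mem_hull ?_ hx
    rintro _ ⟨s, hs, rfl⟩
    rw [toReal_dotProduct]
    exact_mod_cast h s hs

/-- Removing a face from a cone leaves a convex set. -/
theorem convex_diff_face {σ F : PointedCone ℝ (Fin d → ℝ)} (hF : F.IsFaceOf σ) :
    Convex ℝ {x | x ∈ σ ∧ x ∉ F} := by
  rintro x ⟨hx, hxF⟩ y ⟨hy, hyF⟩ a b ha hb hab
  refine ⟨σ.convex hx hy ha hb hab, fun h => ?_⟩
  rcases ha.lt_or_eq with ha' | rfl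
  · exact hxF (hF.mem_of_smul_add_mem hx (σ.smul_mem hb hy) ha' h)
  · obtain rfl : b = 1 := by linarith
    simp at h
    exact hyF h

theorem exists_common_denominator (y : Fin d → ℚ) :
    ∃ D : ℕ, 0 < D ∧ ∃ m : Fin d → ℤ, ∀ i, (m i : ℝ) = D * (y i : ℝ) := by
  refine ⟨∏ i, (y i).den, Finset.prod_pos fun i _ => (y i).den_pos, ?_⟩
  have h : ∀ i, ∃ k : ℤ, (k : ℝ) = ((∏ i, (y i).den : ℕ) : ℝ) * (y i : ℝ) := by
    intro i
    obtain ⟨c, hc⟩ := Finset.dvd_prod_of_mem (fun i => (y i).den) (Finset.mem_univ i)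
    refine ⟨(y i).num * c, ?_⟩
    rw [hc]
    have h1 : ((y i).den : ℚ) * y i = (y i).num := Rat.den_mul_eq_num _
    have h2 : ((y i).den : ℝ) * (y i : ℝ) = (y i).num := by exact_mod_cast h1
    push_cast
    rw [← h2]
    ring
  choose m hm using h
  exact ⟨m, hm⟩

/-- A face which is `{0}` (take `v = 0`) or a ray spanned by an integral vector `v` with
`⟨w, v⟩ = 1` for an integral `w` is cut out of a strongly convex rational cone by an integral
functional. The functional is separated from the convex hull of the remaining generators modulo `v`
and then approximated by a rational one; subtracting a multiple of `w` keeps it zero on `v`. -/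
theorem exists_integral_exposing {σ F : PointedCone ℝ (Fin d → ℝ)} {S : Finset (Fin d → ℤ)}
    (hS : σ = PointedCone.hull ℝ (toReal '' (S : Set (Fin d → ℤ)))) (hconv : IsStronglyConvex σ)
    (hF : F.IsFaceOf σ) {v w : Fin d → ℤ} (hv : toReal v ∈ F) (hw : (w ⬝ᵥ v) • v = v) :
    ∃ m : Fin d → ℤ, m ⬝ᵥ v = 0 ∧ ∀ s ∈ S, toReal s ∉ F → 0 < m ⬝ᵥ s := by
  classical
  let π : (Fin d → ℝ) →ₗ[ℝ] (Fin d → ℝ) :=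
    { toFun := fun x => x - (toReal w ⬝ᵥ x) • toReal v
      map_add' := fun x y => by rw [dotProduct_add, add_smul]; abel
      map_smul' := fun c x => by
        rw [dotProduct_smul, smul_sub, smul_smul, RingHom.id_apply, smul_eq_mul] }
  have hπ : ∀ x, π x = x - (toReal w ⬝ᵥ x) • toReal v := fun _ => rfl
  let S' := S.filter fun s => toReal s ∉ F
  let A : Set (Fin d → ℝ) := toReal '' (S' : Set (Fin d → ℤ))
  have hA : A ⊆ {x | x ∈ σ ∧ x ∉ F} := by
    rintro _ ⟨s, hs, rfl⟩
    have hs' := Finset.mem_filter.1 hs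
    exact ⟨hS ▸ PointedCone.subset_hull ⟨s, hs'.1, rfl⟩, hs'.2⟩
  have h0 : (0 : Fin d → ℝ) ∉ convexHull ℝ (π '' A) := by
    rw [← LinearMap.image_convexHull]
    rintro ⟨y, hy, hy0⟩
    obtain ⟨hyσ, hyF⟩ := convexHull_min hA (convex_diff_face hF) hy
    rw [hπ, sub_eq_zero] at hy0
    rcases le_or_gt 0 (toReal w ⬝ᵥ y) with hc | hc
    · exact hyF (hy0 ▸ F.smul_mem hc hv)
    · refine hyF ?_
      have : y = 0 := hconv y hyσ (by
        rw [hy0, ← neg_smul]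
        exact σ.smul_mem (by linarith) (hF.le hv))
      rw [this]
      exact F.zero_mem
  have hfin : (π '' A).Finite := ((S'.finite_toSet).image _).image _
  obtain ⟨f, c, hfc, hf⟩ := geometric_hahn_banach_point_closed (convex_convexHull ℝ (π '' A))
    (hfin.isClosed_convexHull ℝ) h0
  rw [map_zero] at hfc
  let O : Set (Fin d → ℝ) := ⋂ s ∈ S', {y | 0 < y ⬝ᵥ π (toReal s)}
  have hO : IsOpen O := by
    refine isOpen_biInter_finset fun s _ => ?_
    have h : Continuous fun y : Fin d → ℝ => y ⬝ᵥ π (toReal s) := by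
      simp only [dotProduct]
      fun_prop
    exact isOpen_lt continuous_const h
  have hne : O.Nonempty := by
    refine ⟨fun i => f fun j => if i = j then 1 else 0, Set.mem_iInter₂.2 fun s hs => ?_⟩
    have h1 := hf (π (toReal s)) (subset_convexHull ℝ _ ⟨_, ⟨s, hs, rfl⟩, rfl⟩)
    have h2 := LinearMap.pi_apply_eq_sum_univ (f : (Fin d → ℝ) →ₗ[ℝ] ℝ) (π (toReal s))
    simp only [ContinuousLinearMap.coe_coe] at h2
    rw [Set.mem_ofPred_eq, dotProduct_comm]
    simp only [dotProduct]
    simp only [smul_eq_mul] at h2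
    rw [← h2]
    linarith
  have hdense : DenseRange (Pi.map fun _ : Fin d => ((↑) : ℚ → ℝ)) :=
    DenseRange.piMap fun _ => Rat.denseRange_cast
  obtain ⟨y, hy⟩ := hdense.exists_mem_open hO hne
  obtain ⟨D, hD, m, hm⟩ := exists_common_denominator y
  refine ⟨m - (m ⬝ᵥ v) • w, ?_, fun s hs hsF => ?_⟩
  · rw [sub_dotProduct, smul_dotProduct, sub_eq_zero]
    conv_lhs => rw [← hw]
    rw [dotProduct_smul, smul_eq_mul, smul_eq_mul, mul_comm]
  · have h1 := Set.mem_iInter₂.1 hy s (Finset.mem_filter.2 ⟨hs, hsF⟩)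
    have h2 : toReal m = (D : ℝ) • Pi.map (fun _ : Fin d => Rat.cast) y := by
      funext i; simp [toReal, hm]
    have h3 : 0 < toReal m ⬝ᵥ π (toReal s) := by
      rw [h2, smul_dotProduct]
      exact mul_pos (by exact_mod_cast hD) h1
    rw [hπ, dotProduct_sub, dotProduct_smul, toReal_dotProduct, toReal_dotProduct,
      toReal_dotProduct] at h3
    rw [sub_dotProduct, smul_dotProduct]
    have h4 : (0 : ℝ) < ((m ⬝ᵥ s - (w ⬝ᵥ s) * (m ⬝ᵥ v) : ℤ) : ℝ) := by
      push_cast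
      simpa using h3
    have h5 := Int.cast_pos.1 h4
    rw [smul_eq_mul]
    linarith [mul_comm (w ⬝ᵥ s) (m ⬝ᵥ v)]

theorem exists_add_nsmul_nonneg {S : Finset (Fin d → ℤ)} {P : (Fin d → ℤ) → Prop} {m : Fin d → ℤ}
    (hm : ∀ s ∈ S, P s → 0 < m ⬝ᵥ s) (x : Fin d → ℤ) :
    ∃ N : ℕ, ∀ s ∈ S, P s → 0 ≤ (x + N • m) ⬝ᵥ s := by
  refine ⟨∑ s ∈ S, (x ⬝ᵥ s).natAbs, fun s hs hP => ?_⟩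
  have h1 := hm s hs hP
  have h2 : (x ⬝ᵥ s).natAbs ≤ ∑ s ∈ S, (x ⬝ᵥ s).natAbs :=
    Finset.single_le_sum (f := fun s => (x ⬝ᵥ s).natAbs) (fun _ _ => Nat.zero_le _) hs
  rw [add_dotProduct, smul_dotProduct, nsmul_eq_mul]
  have h3 : -(x ⬝ᵥ s) ≤ ((∑ s ∈ S, (x ⬝ᵥ s).natAbs : ℕ) : ℤ) := by omega
  nlinarith [Int.natCast_nonneg (∑ s ∈ S, (x ⬝ᵥ s).natAbs)]

/-- The dual monoid of a strongly convex rational cone generates the lattice as a group. -/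
theorem exists_add_mem_dualMonoid {σ : PointedCone ℝ (Fin d → ℝ)} (hrat : IsRationalPolyhedral σ)
    (hconv : IsStronglyConvex σ) (z : Fin d → ℤ) :
    ∃ t ∈ dualMonoid σ, z + t ∈ dualMonoid σ := by
  obtain ⟨S, hS⟩ := hrat
  have hF : (⊥ : PointedCone ℝ (Fin d → ℝ)).IsFaceOf σ := by
    refine ⟨bot_le, fun {x y a} hx hy ha h => ?_⟩
    rw [Submodule.mem_bot] at h ⊢
    refine hconv x hx ?_
    have : -x = a⁻¹ • y := by
      rw [eq_neg_of_add_eq_zero_right h, smul_neg, smul_smul, inv_mul_cancel₀ ha.ne', one_smul]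
    rw [this]
    exact σ.smul_mem (by positivity) hy
  obtain ⟨m, -, hm⟩ := exists_integral_exposing (v := 0) (w := 0) hS hconv hF
    (by rw [toReal_zero]; exact Submodule.zero_mem _) (by simp)
  obtain ⟨N, hN⟩ := exists_add_nsmul_nonneg hm z
  have key : ∀ s : Fin d → ℤ, toReal s ∈ (⊥ : PointedCone ℝ (Fin d → ℝ)) → s = 0 := fun s hs =>
    toReal_injective ((Submodule.mem_bot _).1 hs |>.trans toReal_zero.symm)
  refine ⟨N • m, (mem_dualMonoid_hull hS).2 fun s hs => ?_,
    (mem_dualMonoid_hull hS).2 fun s hs => ?_⟩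
  · by_cases h : toReal s ∈ (⊥ : PointedCone ℝ (Fin d → ℝ))
    · rw [key s h, dotProduct_zero]
    · rw [smul_dotProduct]
      exact nsmul_nonneg (hm s hs h).le N
  · by_cases h : toReal s ∈ (⊥ : PointedCone ℝ (Fin d → ℝ))
    · rw [key s h, dotProduct_zero]
    · exact hN s hs h

end

/-! ### Rays and the anticanonical polytope -/

section
variable {d : ℕ}

theorem IsRayOf.exists_smul_eq {σ ρ : PointedCone ℝ (Fin d → ℝ)} (hρ : IsRayOf ρ σ)
    (hconv : IsStronglyConvex σ) {v : Fin d → ℤ} (hv : toReal v ∈ ρ) (hv0 : v ≠ 0)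
    {x : Fin d → ℝ} (hx : x ∈ ρ) : ∃ c : ℝ, 0 ≤ c ∧ x = c • toReal v := by
  have hv' : (⟨toReal v, Submodule.subset_span hv⟩ : Submodule.span ℝ (ρ : Set (Fin d → ℝ))) ≠ 0 := by
    intro h
    exact hv0 (toReal_injective ((congrArg Subtype.val h).trans toReal_zero.symm))
  obtain ⟨c, hc⟩ := (finrank_eq_one_iff_of_nonzero' _ hv').1 hρ.2 ⟨x, Submodule.subset_span hx⟩
  have hc' : c • toReal v = x := congrArg Subtype.val hc
  rcases le_or_gt 0 c with h | h
  · exact ⟨c, h, hc'.symm⟩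
  · refine ⟨0, le_rfl, ?_⟩
    rw [zero_smul]
    refine hconv x (hρ.1.le hx) ?_
    rw [← hc', ← neg_smul]
    exact σ.smul_mem (by linarith) (hρ.1.le hv)

theorem dotProduct_self_pos {v : Fin d → ℤ} (hv : v ≠ 0) : 0 < v ⬝ᵥ v :=
  lt_of_le_of_ne (Finset.sum_nonneg fun i _ => mul_self_nonneg (v i))
    fun h => hv (dotProduct_self_eq_zero.1 h.symm)

theorem exists_isPrimitiveGenerator {ρ : PointedCone ℝ (Fin d → ℝ)} {s : Fin d → ℤ}
    (hs : toReal s ∈ ρ) (hs0 : s ≠ 0) : ∃ v, IsPrimitiveGenerator v ρ := by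
  obtain ⟨v, ⟨hv, hv0⟩, hmin⟩ := WellFounded.has_min
    (measure fun v : Fin d → ℤ => (v ⬝ᵥ v).toNat).wf {v | toReal v ∈ ρ ∧ v ≠ 0} ⟨s, hs, hs0⟩
  refine ⟨v, hv, hv0, fun w hw hw0 => ?_⟩
  have h1 : ¬ (w ⬝ᵥ w).toNat < (v ⬝ᵥ v).toNat := hmin w ⟨hw, hw0⟩
  have h2 := dotProduct_self_pos hw0
  omega

/-- The coordinates of a shortest lattice vector of a cone have greatest common divisor `1`. -/
theorem IsPrimitiveGenerator.exists_dotProduct_eq_one {ρ : PointedCone ℝ (Fin d → ℝ)}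
    {v : Fin d → ℤ} (hv : IsPrimitiveGenerator v ρ) : ∃ w : Fin d → ℤ, w ⬝ᵥ v = 1 := by
  obtain ⟨hvρ, hv0, hmin⟩ := hv
  obtain ⟨g, hg⟩ := (IsPrincipalIdealRing.principal (Ideal.span (Set.range v))).principal
  have hdvd : ∀ i, g ∣ v i := fun i => Ideal.mem_span_singleton.1
    ((show Ideal.span (Set.range v) = Ideal.span {g} from hg) ▸ Ideal.subset_span ⟨i, rfl⟩)
  have hmem : g ∈ Ideal.span (Set.range v) := by
    rw [show Ideal.span (Set.range v) = Ideal.span {g} from hg]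
    exact Ideal.mem_span_singleton_self g
  obtain ⟨w, hw⟩ := Ideal.mem_span_range_iff_exists_fun.1 hmem
  choose u hu using hdvd
  have hvu : v = g • u := funext hu
  have hg0 : g ≠ 0 := by
    rintro rfl
    exact hv0 (by rw [hvu, zero_smul])
  have hu0 : u ≠ 0 := by
    rintro rfl
    exact hv0 (by rw [hvu, smul_zero])
  -- `v / |g|`, which is `u` up to sign, also lies in the cone, so that `|g| = 1`
  have hmem' : toReal (g.sign • u) ∈ ρ := by
    have h1 : toReal (g.sign • u) = |(g : ℝ)|⁻¹ • toReal v := by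
      rw [hvu, toReal_zsmul, toReal_zsmul, smul_smul]
      congr 1
      have : (g : ℝ) ≠ 0 := by exact_mod_cast hg0
      rw [eq_inv_mul_iff_mul_eq₀ (abs_ne_zero.2 this)]
      have h2 : |g| * g.sign = g := by rw [mul_comm]; exact Int.sign_mul_abs g
      exact_mod_cast h2
    rw [h1]
    exact ρ.smul_mem (by positivity) hvρ
  have hs2 : g.sign * g.sign = 1 := by
    rcases lt_or_gt_of_ne hg0 with h | h
    · rw [Int.sign_eq_neg_one_of_neg h]; norm_num
    · rw [Int.sign_eq_one_of_pos h]; norm_num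
  have hne : g.sign • u ≠ 0 := smul_ne_zero (by intro h; rw [h] at hs2; simp at hs2) hu0
  have h3 := hmin _ hmem' hne
  rw [hvu, smul_dotProduct, dotProduct_smul, smul_dotProduct, dotProduct_smul] at h3
  simp only [smul_eq_mul, ← mul_assoc] at h3
  rw [hs2, one_mul] at h3
  have h4 : g * g ≤ 1 := by
    have := dotProduct_self_pos hu0
    nlinarith
  have h5 : g * g = 1 := by
    have : 0 < g * g := mul_self_pos.2 hg0
    omega
  refine ⟨g • w, ?_⟩
  rw [smul_dotProduct]
  have : w ⬝ᵥ v = g := hw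
  rw [this, smul_eq_mul, h5]

/-- A member of a minimal system of generators of a strongly convex cone generates a ray. -/
theorem isRayOf_hull_singleton {σ : PointedCone ℝ (Fin d → ℝ)} (hconv : IsStronglyConvex σ)
    {T : Set (Fin d → ℝ)} {x : Fin d → ℝ} (hσ : σ = PointedCone.hull ℝ (insert x T))
    (hx : x ∉ PointedCone.hull ℝ T) : IsRayOf (PointedCone.hull ℝ {x}) σ := by
  have hTσ : PointedCone.hull ℝ T ≤ σ := hσ ▸ Submodule.span_mono (Set.subset_insert _ _)
  have hxσ : x ∈ σ := hσ ▸ PointedCone.subset_hull (Set.mem_insert _ _)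
  have hdec : ∀ y ∈ σ, ∃ c : ℝ, 0 ≤ c ∧ ∃ z ∈ PointedCone.hull ℝ T, y = c • x + z := by
    intro y hy
    rw [hσ] at hy
    obtain ⟨c, z, hz, h⟩ := Submodule.mem_span_insert.1 hy
    exact ⟨c, c.2, z, hz, h⟩
  refine ⟨⟨?_, ?_⟩, ?_⟩
  · exact Submodule.span_le.2 (Set.singleton_subset_iff.2 hxσ)
  · intro y z a hy hz ha h
    obtain ⟨c, hc⟩ := Submodule.mem_span_singleton.1 h
    have hc' : (c : ℝ) • x = a • y + z := hc
    obtain ⟨α, hα, y', hy', rfl⟩ := hdec y hy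
    obtain ⟨β, hβ, z', hz', rfl⟩ := hdec z hz
    have h1 : a • y' + z' = ((c : ℝ) - a * α - β) • x := by
      rw [sub_smul, sub_smul, hc', smul_add, mul_smul]
      abel
    rcases lt_or_ge 0 ((c : ℝ) - a * α - β) with hpos | hneg
    · refine absurd ?_ hx
      have h2 : x = ((c : ℝ) - a * α - β)⁻¹ • (a • y' + z') := by
        rw [h1, smul_smul, inv_mul_cancel₀ hpos.ne', one_smul]
      rw [h2]
      exact PointedCone.smul_mem _ (by positivity)
        (Submodule.add_mem _ (PointedCone.smul_mem _ ha.le hy') hz')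
    · have h2 : y' = 0 := by
        refine hconv y' (hTσ hy') ?_
        have h3 : -y' = a⁻¹ • (z' + (-((c : ℝ) - a * α - β)) • x) := by
          rw [neg_smul, ← h1, neg_add, add_comm (-(a • y')), add_neg_cancel_left, smul_neg,
            smul_smul, inv_mul_cancel₀ ha.ne', one_smul]
        rw [h3]
        exact σ.smul_mem (by positivity)
          (σ.add_mem (hTσ hz') (σ.smul_mem (by linarith) hxσ))
      rw [h2, add_zero]
      exact PointedCone.smul_mem _ hα (PointedCone.subset_hull rfl)
  · have hx0 : x ≠ 0 := by
      rintro rfl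
      exact hx (Submodule.zero_mem _)
    have : Submodule.span ℝ ((PointedCone.hull ℝ {x} : PointedCone ℝ (Fin d → ℝ)) :
        Set (Fin d → ℝ)) = Submodule.span ℝ {x} := by
      refine le_antisymm (Submodule.span_le.2 ?_) (Submodule.span_mono PointedCone.subset_hull)
      exact PointedCone.hull_le_span ℝ {x}
    rw [this, finrank_span_singleton hx0]

/-- A strongly convex rational cone is generated by lattice vectors of its rays. -/
theorem exists_generators_of_rays {σ : PointedCone ℝ (Fin d → ℝ)} (hrat : IsRationalPolyhedral σ)
    (hconv : IsStronglyConvex σ) : ∃ S : Finset (Fin d → ℤ),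
      σ = PointedCone.hull ℝ (toReal '' (S : Set (Fin d → ℤ))) ∧
      ∀ s ∈ S, s ≠ 0 ∧ IsRayOf (PointedCone.hull ℝ {toReal s}) σ := by
  classical
  -- a system of generators with the fewest elements
  obtain ⟨S, hS, hmin⟩ := WellFounded.has_min
    (measure fun S : Finset (Fin d → ℤ) => S.card).wf
    {S | σ = PointedCone.hull ℝ (toReal '' (S : Set (Fin d → ℤ)))} hrat
  refine ⟨S, hS, fun s hs => ?_⟩
  have hσ : σ = PointedCone.hull ℝ (insert (toReal s)
      (toReal '' ((S.erase s : Finset (Fin d → ℤ)) : Set (Fin d → ℤ)))) := by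
    rw [← Set.image_insert_eq, ← Finset.coe_insert, Finset.insert_erase hs]
    exact hS
  have hx : toReal s ∉ PointedCone.hull ℝ
      (toReal '' ((S.erase s : Finset (Fin d → ℤ)) : Set (Fin d → ℤ))) := by
    intro h
    refine hmin (S.erase s) ?_ (Finset.card_erase_lt_of_mem hs)
    exact hσ.trans (Submodule.span_insert_eq_span h)
  refine ⟨?_, isRayOf_hull_singleton hconv hσ hx⟩
  rintro rfl
  exact hx (by rw [toReal_zero]; exact Submodule.zero_mem _)

/-- The dual cone is cut out by the inequalities of the rays. -/
theorem mem_dualMonoid_iff_rays {σ : PointedCone ℝ (Fin d → ℝ)} (hrat : IsRationalPolyhedral σ)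
    (hconv : IsStronglyConvex σ) {m : Fin d → ℤ} : m ∈ dualMonoid σ ↔
      ∀ (ρ : PointedCone ℝ (Fin d → ℝ)) (v : Fin d → ℤ), IsRayOf ρ σ → IsPrimitiveGenerator v ρ →
        0 ≤ m ⬝ᵥ v := by
  constructor
  · intro h ρ v hρ hv
    have h1 := h (toReal v) (hρ.1.le hv.1)
    rw [toReal_dotProduct] at h1
    exact_mod_cast h1
  · intro h
    obtain ⟨S, hS, hray⟩ := exists_generators_of_rays hrat hconv
    refine (mem_dualMonoid_hull hS).2 fun s hs => ?_
    obtain ⟨hs0, hρ⟩ := hray s hs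
    have hsρ : toReal s ∈ PointedCone.hull ℝ {toReal s} := PointedCone.subset_hull rfl
    obtain ⟨v, hv⟩ := exists_isPrimitiveGenerator hsρ hs0
    obtain ⟨c, hc, hsv⟩ := hρ.exists_smul_eq hconv hv.1 hv.2.1 hsρ
    have h1 : (0 : ℝ) ≤ (m ⬝ᵥ s : ℤ) := by
      rw [← toReal_dotProduct, hsv, dotProduct_smul, toReal_dotProduct]
      exact mul_nonneg hc (by exact_mod_cast h _ v hρ hv)
    exact_mod_cast h1

/-- A ray of a cone contains a nonzero member of every system of generators. -/
theorem IsRayOf.exists_generator_mem {σ ρ : PointedCone ℝ (Fin d → ℝ)} (hρ : IsRayOf ρ σ)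
    {S : Finset (Fin d → ℤ)} (hS : σ = PointedCone.hull ℝ (toReal '' (S : Set (Fin d → ℤ))))
    {v : Fin d → ℤ} (hv : toReal v ∈ ρ) (hv0 : v ≠ 0) : ∃ s ∈ S, toReal s ∈ ρ ∧ s ≠ 0 := by
  by_contra! hcon
  have key : ∀ x ∈ PointedCone.hull ℝ (toReal '' (S : Set (Fin d → ℤ))), x ∈ ρ → x = 0 := by
    intro x hx
    induction hx using Submodule.span_induction with
    | mem x hx =>
      obtain ⟨s, hs, rfl⟩ := hx
      intro h
      rw [hcon s hs h, toReal_zero]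
    | zero => exact fun _ => rfl
    | add x y hx hy ihx ihy =>
      intro h
      rw [ihx (hρ.1.mem_of_add_mem_left (hS ▸ hx) (hS ▸ hy) h),
        ihy (hρ.1.mem_of_add_mem_right (hS ▸ hx) (hS ▸ hy) h), add_zero]
    | smul a x hx ih =>
      intro h
      rcases a.2.lt_or_eq with ha | ha
      · have hxρ : x ∈ ρ := hρ.1.mem_of_smul_add_mem (hS ▸ hx) σ.zero_mem ha
          (by rw [add_zero]; exact h)
        rw [ih hxρ, smul_zero]
      · have : a = 0 := Subtype.ext ha.symm
        rw [this, zero_smul]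
  exact hv0 (toReal_injective ((key _ (hS ▸ hρ.1.le hv) hv).trans toReal_zero.symm))

/-- A rational polyhedral cone has finitely many rays. -/
theorem finite_primitiveGenerators {σ : PointedCone ℝ (Fin d → ℝ)}
    (hrat : IsRationalPolyhedral σ) :
    {v : Fin d → ℤ | ∃ ρ, IsRayOf ρ σ ∧ IsPrimitiveGenerator v ρ}.Finite := by
  obtain ⟨S, hS⟩ := hrat
  -- the shortest vector of a ray is at most as long as a generator of the cone on that ray
  let B : ℤ := ∑ s ∈ S, s ⬝ᵥ s
  refine (Set.finite_Icc (fun _ : Fin d => -B) fun _ => B).subset ?_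
  rintro v ⟨ρ, hρ, hv⟩
  obtain ⟨s, hs, hsρ, hs0⟩ := hρ.exists_generator_mem hS hv.1 hv.2.1
  have hnn : ∀ u : Fin d → ℤ, 0 ≤ u ⬝ᵥ u := fun u =>
    Finset.sum_nonneg fun i _ => mul_self_nonneg (u i)
  have h1 : v ⬝ᵥ v ≤ B := (hv.2.2 s hsρ hs0).trans
    (Finset.single_le_sum (f := fun s : Fin d → ℤ => s ⬝ᵥ s) (fun u _ => hnn u) hs)
  have h2 : ∀ i, v i * v i ≤ B := fun i => le_trans
    (Finset.single_le_sum (f := fun i => v i * v i) (fun i _ => mul_self_nonneg (v i))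
      (Finset.mem_univ i)) h1
  exact ⟨fun i => by change -B ≤ v i; nlinarith [h2 i], fun i => by
    change v i ≤ B; nlinarith [h2 i]⟩

/-- Interior points satisfy the inequalities strictly because `⟨v, v⟩ > 0`; the converse needs that
there are finitely many rays. -/
theorem mem_interior_anticanonicalPolytope {σ : PointedCone ℝ (Fin d → ℝ)}
    (hrat : IsRationalPolyhedral σ) {u : Fin d → ℝ} :
    u ∈ interior (anticanonicalPolytope σ) ↔
      ∀ (ρ : PointedCone ℝ (Fin d → ℝ)) (v : Fin d → ℤ), IsRayOf ρ σ → IsPrimitiveGenerator v ρ →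
        -1 < u ⬝ᵥ toReal v := by
  constructor
  · intro hu ρ v hρ hv
    have hc : Filter.Tendsto (fun t : ℝ => u - t • toReal v) (nhdsWithin 0 (Set.Ioi 0))
        (nhds u) := by
      have : Continuous fun t : ℝ => u - t • toReal v := by fun_prop
      have h := this.tendsto 0
      simp only [zero_smul, sub_zero] at h
      exact h.mono_left nhdsWithin_le_nhds
    obtain ⟨t, ht, ht0⟩ := ((hc.eventually (mem_interior_iff_mem_nhds.1 hu)).and
      self_mem_nhdsWithin).exists
    have h1 : -1 ≤ (u - t • toReal v) ⬝ᵥ toReal v := ht ρ v hρ hv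
    rw [sub_dotProduct, smul_dotProduct, toReal_dotProduct, smul_eq_mul] at h1
    have h2 : (0 : ℝ) < (v ⬝ᵥ v : ℤ) := by exact_mod_cast dotProduct_self_pos hv.2.1
    have h3 : 0 < t * (v ⬝ᵥ v : ℤ) := mul_pos ht0 h2
    linarith
  · intro hu
    refine mem_interior.2 ⟨⋂ v ∈ {v : Fin d → ℤ | ∃ ρ, IsRayOf ρ σ ∧ IsPrimitiveGenerator v ρ},
      {x | -1 < x ⬝ᵥ toReal v}, ?_, ?_, ?_⟩
    · intro x hx ρ v hρ hv
      exact (Set.mem_iInter₂.1 hx v ⟨ρ, hρ, hv⟩).le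
    · refine (finite_primitiveGenerators hrat).isOpen_biInter fun v _ => ?_
      have h : Continuous fun x : Fin d → ℝ => x ⬝ᵥ toReal v := by
        simp only [dotProduct]
        fun_prop
      exact isOpen_lt continuous_const h
    · refine Set.mem_iInter₂.2 ?_
      rintro v ⟨ρ, hρ, hv⟩
      exact hu ρ v hρ hv

end

/-- Translation by `b / q` maps those points of the dual cone lying in `(1 / q) ℤ^d` whose
translate is integral into the dual cone. Everything is scaled by `q`. -/
def ShiftPreserves {d : ℕ} (q : ℕ) (σ : PointedCone ℝ (Fin d → ℝ)) (b : Fin d → ℤ) : Prop :=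
  ∀ u ∈ dualMonoid σ, ∀ w : Fin d → ℤ, q • w = b + u → w ∈ dualMonoid σ

/-- Interior points of the anticanonical polytope are those whose `π_a` preserves the toric ring.
If `⟨a, v⟩ > -1` on a ray, the integer `⟨a + u, v⟩` exceeds `-1`. If `⟨a, v⟩ ≤ -1`, take `w`
integral with `⟨w, v⟩ = -1` and move it far along the facet dual to `v`: then `w - a` lies in the
dual cone and `w` does not. -/
theorem frac_mem_interior_iff {d : ℕ} {σ : PointedCone ℝ (Fin d → ℝ)}
    (hrat : IsRationalPolyhedral σ) (hconv : IsStronglyConvex σ) (p e : ℕ) [NeZero p]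
    (b : Fin d → ℤ) :
    frac p e b ∈ interior (anticanonicalPolytope σ) ↔ ShiftPreserves (p ^ e) σ b := by
  have hq : 0 < p ^ e := pow_pos (NeZero.pos p) e
  have hfrac : ∀ v : Fin d → ℤ, -1 < frac p e b ⬝ᵥ toReal v ↔ -((p ^ e : ℕ) : ℤ) < b ⬝ᵥ v := by
    intro v
    have h1 : frac p e b = (((p ^ e : ℕ) : ℝ))⁻¹ • toReal b := by
      funext i
      simp [frac, toReal, div_eq_inv_mul]
    rw [h1, smul_dotProduct, toReal_dotProduct, smul_eq_mul, ← div_eq_inv_mul,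
      lt_div_iff₀ (by exact_mod_cast hq)]
    constructor
    · intro h
      have : ((-((p ^ e : ℕ) : ℤ) : ℤ) : ℝ) < (b ⬝ᵥ v : ℤ) := by push_cast at h ⊢; linarith
      exact_mod_cast this
    · intro h
      have : ((-((p ^ e : ℕ) : ℤ) : ℤ) : ℝ) < (b ⬝ᵥ v : ℤ) := by exact_mod_cast h
      push_cast at this ⊢
      linarith
  rw [mem_interior_anticanonicalPolytope hrat]
  simp only [hfrac]
  generalize p ^ e = q at hq
  have hq' : (0 : ℤ) < q := by exact_mod_cast hq
  have hsmul : ∀ (c : ℕ) (x y : Fin d → ℤ), (c • x) ⬝ᵥ y = c * (x ⬝ᵥ y) := fun c x y => by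
    rw [smul_dotProduct, nsmul_eq_mul]
  constructor
  · intro h u hu w hw
    rw [mem_dualMonoid_iff_rays hrat hconv] at hu ⊢
    intro ρ v hρ hv
    have h1 := congrArg (· ⬝ᵥ v) hw
    simp only [hsmul, add_dotProduct] at h1
    have h2 := h ρ v hρ hv
    have h3 := hu ρ v hρ hv
    by_contra! hneg
    have h4 : (q : ℤ) * (w ⬝ᵥ v) ≤ q * (-1) := by gcongr; omega
    linarith
  · intro h ρ v hρ hv
    by_contra! hcon
    obtain ⟨S, hS⟩ := hrat
    obtain ⟨w, hw⟩ := hv.exists_dotProduct_eq_one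
    obtain ⟨m, hm0, hm⟩ := exists_integral_exposing (F := ρ) hS hconv hρ.1 (w := w) hv.1
      (by rw [hw, one_smul])
    obtain ⟨N, hN⟩ := exists_add_nsmul_nonneg hm (q • (-w) - b)
    have hval : (-w + N • m) ⬝ᵥ v = -1 := by
      rw [add_dotProduct, smul_dotProduct, hm0, neg_dotProduct, hw]
      simp
    have hmem : q • (-w + N • m) - b ∈ dualMonoid σ := by
      refine (mem_dualMonoid_hull hS).2 fun s hs => ?_
      by_cases hsρ : toReal s ∈ ρ
      · obtain ⟨c, hc, hsv⟩ := hρ.exists_smul_eq hconv hv.1 hv.2.1 hsρ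
        have h1 : (0 : ℝ) ≤ ((q • (-w + N • m) - b) ⬝ᵥ s : ℤ) := by
          rw [← toReal_dotProduct, hsv, dotProduct_smul, toReal_dotProduct]
          refine mul_nonneg hc ?_
          rw [sub_dotProduct, smul_dotProduct, hval]
          have : 0 ≤ q • (-1 : ℤ) - b ⬝ᵥ v := by rw [nsmul_eq_mul]; linarith
          exact_mod_cast this
        exact_mod_cast h1
      · have h1 := hN s hs hsρ
        have h2 : 0 ≤ m ⬝ᵥ s := (hm s hs hsρ).le
        simp only [add_dotProduct, sub_dotProduct, hsmul] at h1 ⊢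
        have h3 : (N : ℤ) * (m ⬝ᵥ s) ≤ q * (N * (m ⬝ᵥ s)) :=
          le_mul_of_one_le_left (by positivity) (by omega)
        rw [mul_add]
        linarith
    have h5 := h _ hmem (-w + N • m) (by abel)
    have h6 := (mem_dualMonoid_iff_rays ⟨S, hS⟩ hconv).1 h5 ρ v hρ hv
    rw [hval] at h6
    norm_num at h6

/-! ### Cartier maps on algebras with a multiplicative basis -/

section
variable {k A N : Type*} [Field k] [CommRing A] [Algebra k A]

theorem basis_induction (β : Module.Basis N k A) {P : A → Prop} (h0 : P 0)
    (hadd : ∀ x y, P x → P y → P (x + y)) (hsmul : ∀ (c : k) (m : N), P (c • β m)) (x : A) :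
    P x := by
  obtain ⟨f, rfl⟩ := β.repr.symm.surjective x
  induction f using Finsupp.induction_linear with
  | zero => rw [map_zero]; exact h0
  | add f g hf hg => rw [map_add]; exact hadd _ _ hf hg
  | single m c => rw [Module.Basis.repr_symm_single]; exact hsmul c m

variable [AddCommMonoid N] {β : Module.Basis N k A}

/-- The element `β 0` is neutral for the multiplication of basis elements, hence of `A`. -/
theorem multiplicative_basis_zero (hβ : ∀ m m', β (m + m') = β m * β m') : β 0 = 1 := by
  have h : ∀ x, β 0 * x = x := fun x => by
    refine basis_induction β (P := fun x => β 0 * x = x) (mul_zero _) ?_ ?_ x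
    · intro x y hx hy
      rw [mul_add, hx, hy]
    · intro c m
      rw [mul_smul_comm, ← hβ, zero_add]
  rw [← mul_one (β 0), h 1]

theorem multiplicative_basis_nsmul (hβ : ∀ m m', β (m + m') = β m * β m') (q : ℕ) (m : N) :
    β (q • m) = β m ^ q := by
  induction q with
  | zero => rw [zero_smul, pow_zero, multiplicative_basis_zero hβ]
  | succ q ih => rw [succ_nsmul, hβ, ih, pow_succ]

theorem repr_basis_mul (hβ : ∀ m m', β (m + m') = β m * β m') (t : N) (x : A) :
    β.repr (β t * x) = (β.repr x).mapDomain (t + ·) := by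
  induction x using basis_induction β with
  | h0 => simp
  | hadd x y hx hy => rw [mul_add, map_add, hx, hy, map_add, Finsupp.mapDomain_add]
  | hsmul c m => simp [← hβ, Finsupp.mapDomain_single]

end

section
variable {k A : Type*} [Field k] [CommRing A] [Algebra k A] (p e : ℕ) [ExpChar k p]
  [PerfectRing k p] [ExpChar A p]

theorem root_smul (c : k) (x : A) : root p e A (c • x) =
    algebraMap k A ((iterateFrobeniusEquiv k p e).symm c) • root p e A x := by
  have h : (iterateFrobeniusEquiv k p e).symm c ^ p ^ e = c := by
    rw [← iterateFrobenius_def, ← coe_iterateFrobeniusEquiv, RingEquiv.apply_symm_apply]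
  rw [smul_root, ← map_pow, h, Algebra.smul_def]

variable {N : Type*} [AddCommMonoid N] {β : Module.Basis N k A}

/-- A Cartier map over a perfect field can be prescribed on the roots of a multiplicative basis
subject only to compatibility with multiplication by basis elements. -/
theorem exists_cartier_of_basis (hβ : ∀ m m', β (m + m') = β m * β m') (g : N → A)
    (hg : ∀ t m, g (p ^ e • t + m) = β t * g m) :
    ∃ φ : Cartier p e A, ∀ m, φ (root p e A (β m)) = g m := by
  let G : A →+ A := (Finsupp.liftAddHom fun m : N => (AddMonoidHom.mulRight (g m)).comp
    (((algebraMap k A).comp (iterateFrobeniusEquiv k p e).symm.toRingHom : k →+* A) :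
      k →+ A)).comp (β.repr : A →+ (N →₀ k))
  have hG : ∀ c m, G (c • β m) = algebraMap k A ((iterateFrobeniusEquiv k p e).symm c) * g m := by
    intro c m
    simp [G]
  have hmul : ∀ r f, G (r ^ p ^ e * f) = r * G f := by
    intro r f
    induction r using basis_induction β with
    | h0 => rw [zero_pow (pow_ne_zero _ (expChar_ne_zero A p)), zero_mul, zero_mul, map_zero]
    | hadd r s hr hs => rw [add_pow_expChar_pow, add_mul, map_add, hr, hs, add_mul]
    | hsmul c t =>
      induction f using basis_induction β with
      | h0 => simp
      | hadd x y hx hy => rw [mul_add, map_add, hx, hy, map_add, mul_add]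
      | hsmul s m =>
        have h1 : (iterateFrobeniusEquiv k p e).symm (c ^ p ^ e) = c := by
          rw [← iterateFrobenius_def, ← coe_iterateFrobeniusEquiv, RingEquiv.symm_apply_apply]
        rw [smul_pow, ← multiplicative_basis_nsmul hβ, smul_mul_smul_comm, ← hβ, hG, hG, hg,
          map_mul, h1, map_mul, Algebra.smul_def]
        ring
  refine ⟨{ toFun := fun x => G ((root p e A).symm x)
            map_add' := fun x y => by rw [map_add, map_add]
            map_smul' := fun r x => ?_ }, fun m => ?_⟩
  · obtain ⟨f, rfl⟩ := (root p e A).surjective x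
    rw [smul_root, RingEquiv.symm_apply_apply, RingEquiv.symm_apply_apply, hmul]
    rfl
  · change G ((root p e A).symm (root p e A (β m))) = g m
    rw [RingEquiv.symm_apply_apply, ← one_smul k (β m), hG, map_one, map_one, one_mul]

end

section
variable {k A N : Type*} [Field k] [CommRing A] [Algebra k A] (p e : ℕ) [ExpChar k p]
  [PerfectRing k p] [ExpChar A p]

/-- Compatibility of Cartier maps with a ring homomorphism can be checked on the roots of a
basis. -/
theorem cartier_comm_of_basis (β : Module.Basis N k A) {A' : Type*} [CommRing A'] [Algebra k A']
    [ExpChar A' p] (f : A →+* A') (hf : ∀ c, f (algebraMap k A c) = algebraMap k A' c)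
    (φ : Cartier p e A) (ψ : Cartier p e A')
    (h : ∀ m, f (φ (root p e A (β m))) = ψ (root p e A' (f (β m)))) (z : FrobRoot p e A) :
    f (φ z) = ψ (FrobRoot.map p e f z) := by
  obtain ⟨x, rfl⟩ := (root p e A).surjective z
  have hmap : ∀ x, FrobRoot.map p e f (root p e A x) = root p e A' (f x) := fun _ => rfl
  rw [hmap]
  induction x using basis_induction β with
  | h0 => simp
  | hadd x y hx hy => simp only [map_add, hx, hy]
  | hsmul c m =>
    have h1 : f (c • β m) = c • f (β m) := by rw [Algebra.smul_def, Algebra.smul_def, map_mul, hf]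
    rw [h1, root_smul, root_smul, φ.map_smul, ψ.map_smul, smul_eq_mul, smul_eq_mul, map_mul, hf, h]

theorem cartier_ext_of_basis (β : Module.Basis N k A) {φ ψ : Cartier p e A}
    (h : ∀ m, φ (root p e A (β m)) = ψ (root p e A (β m))) : φ = ψ :=
  LinearMap.ext fun z =>
    cartier_comm_of_basis p e β (RingHom.id A) (fun _ => rfl) φ ψ h z

end

section
variable {k A N : Type*} [Field k] [CommRing A] [Algebra k A] [AddCommMonoid N] {p e : ℕ}
  [ExpChar A p] {β : Module.Basis N k A} (φ : Cartier p e A)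

theorem cartier_root_basis_nsmul_add (hβ : ∀ m m', β (m + m') = β m * β m') (t u : N) :
    φ (root p e A (β (p ^ e • t + u))) = β t * φ (root p e A (β u)) := by
  rw [hβ, multiplicative_basis_nsmul hβ, ← smul_root, map_smul, smul_eq_mul]

theorem repr_cartier_shift [IsLeftCancelAdd N] (hβ : ∀ m m', β (m + m') = β m * β m')
    (t u w : N) : β.repr (φ (root p e A (β (p ^ e • t + u)))) (t + w) =
      β.repr (φ (root p e A (β u))) w := by
  rw [cartier_root_basis_nsmul_add φ hβ, repr_basis_mul hβ,
    Finsupp.mapDomain_apply (add_right_injective t)]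

/-- If `x ^ w` occurs in `φ((x ^ u) ^ {1/q})`, then translating `u` and `w` by a difference
`t - s` for which `u' = u + q (t - s)` lies in the monoid keeps `w` in the monoid. -/
theorem exists_add_eq_of_repr_cartier_ne_zero [IsLeftCancelAdd N]
    (hβ : ∀ m m', β (m + m') = β m * β m') {u w u' t s : N}
    (h : β.repr (φ (root p e A (β u))) w ≠ 0) (hu : p ^ e • t + u = p ^ e • s + u') :
    ∃ w', t + w = s + w' := by
  by_contra! hcon
  apply h
  rw [← repr_cartier_shift φ hβ t, hu, cartier_root_basis_nsmul_add φ hβ, repr_basis_mul hβ]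
  exact Finsupp.mapDomain_of_notMem_range _ _ fun ⟨w', hw'⟩ => hcon w' hw'.symm

end

/-! ### Cartier maps of a toric ring -/

/-- The basis of monomials of the toric ring. -/
noncomputable def toricBasis (k : Type*) [Field k] {d : ℕ} (σ : PointedCone ℝ (Fin d → ℝ)) :
    Module.Basis (dualMonoid σ) k (ToricRing k σ) :=
  AddMonoidAlgebra.basis (dualMonoid σ) k

section
variable {k : Type*} [Field k] {d : ℕ} {σ : PointedCone ℝ (Fin d → ℝ)}

theorem toricBasis_add (m m' : dualMonoid σ) :
    toricBasis k σ (m + m') = toricBasis k σ m * toricBasis k σ m' := by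
  simp [toricBasis, AddMonoidAlgebra.single_mul_single]

theorem toricIncl_toricBasis (m : dualMonoid σ) :
    toricIncl k σ (toricBasis k σ m) = .single (m : Fin d → ℤ) 1 := by
  simp [toricBasis, toricIncl]

theorem toricIncl_algebraMap (c : k) :
    toricIncl k σ (algebraMap k (ToricRing k σ) c) = algebraMap k (TorusRing k d) c := by
  simp [toricIncl]

theorem toricIncl_injective : Function.Injective (toricIncl k σ) :=
  AddMonoidAlgebra.mapDomain_injective (f := (dualMonoid σ).subtype) Subtype.val_injective

theorem nsmul_left_cancel {q : ℕ} (hq : 0 < q) {w w' : Fin d → ℤ} (h : q • w = q • w') :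
    w = w' :=
  smul_right_injective (Fin d → ℤ) hq.ne' h

variable {p e : ℕ} [ExpChar k p] [PerfectRing k p] [NeZero p]

theorem IsRestriction.apply_of_eq {φ : Cartier p e (ToricRing k σ)} {b : Fin d → ℤ}
    (h : IsRestriction k p e σ φ (piMap k p e b)) {u w : dualMonoid σ}
    (hw : p ^ e • (w : Fin d → ℤ) = b + u) :
    φ (root p e _ (toricBasis k σ u)) = toricBasis k σ w := by
  apply toricIncl_injective
  rw [h, toricIncl_toricBasis]
  change piFun k p e b (toricIncl k σ (toricBasis k σ u)) = _
  rw [toricIncl_toricBasis, ← sub_eq_of_eq_add' hw, piFun_single, map_one]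

theorem IsRestriction.apply_of_ne {φ : Cartier p e (ToricRing k σ)} {b : Fin d → ℤ}
    (h : IsRestriction k p e σ φ (piMap k p e b)) {u : dualMonoid σ}
    (hw : ∀ w : Fin d → ℤ, p ^ e • w ≠ b + u) : φ (root p e _ (toricBasis k σ u)) = 0 := by
  apply toricIncl_injective
  rw [h, map_zero]
  change piFun k p e b (toricIncl k σ (toricBasis k σ u)) = _
  rw [toricIncl_toricBasis, piFun_single_of_ne]
  intro w hw'
  refine hw w ?_
  rw [hw']
  abel

theorem ShiftPreserves.exists_isRestriction {b : Fin d → ℤ} (hb : ShiftPreserves (p ^ e) σ b) :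
    ∃ φ : Cartier p e (ToricRing k σ), IsRestriction k p e σ φ (piMap k p e b) := by
  classical
  have hq : 0 < p ^ e := pow_pos (NeZero.pos p) e
  let g : dualMonoid σ → ToricRing k σ := fun u =>
    if h : ∃ w : dualMonoid σ, p ^ e • (w : Fin d → ℤ) = b + u then toricBasis k σ h.choose else 0
  have hg1 : ∀ u w : dualMonoid σ, p ^ e • (w : Fin d → ℤ) = b + u → g u = toricBasis k σ w := by
    intro u w hw
    have h : ∃ w : dualMonoid σ, p ^ e • (w : Fin d → ℤ) = b + u := ⟨w, hw⟩
    have h2 : h.choose = w := Subtype.ext (nsmul_left_cancel hq (h.choose_spec.trans hw.symm))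
    simp only [g, dif_pos h, h2]
  have hg2 : ∀ u : dualMonoid σ, (∀ w : Fin d → ℤ, p ^ e • w ≠ b + u) → g u = 0 :=
    fun u h => dif_neg fun ⟨w, hw⟩ => h w hw
  obtain ⟨φ, hφ⟩ := exists_cartier_of_basis p e (β := toricBasis k σ) toricBasis_add g (by
    intro t u
    by_cases h : ∃ w : Fin d → ℤ, p ^ e • w = b + u
    · obtain ⟨w, hw⟩ := h
      rw [hg1 u ⟨w, hb u u.2 w hw⟩ hw, ← toricBasis_add, hg1]
      simp only [AddSubmonoid.coe_add, AddSubmonoidClass.coe_nsmul, smul_add, hw]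
      abel
    · push Not at h
      rw [hg2 u h, mul_zero, hg2]
      intro w hw
      refine h (w - t) ?_
      rw [smul_sub, hw, AddSubmonoid.coe_add, AddSubmonoidClass.coe_nsmul]
      abel)
  refine ⟨φ, cartier_comm_of_basis p e (toricBasis k σ) (toricIncl k σ) toricIncl_algebraMap φ _
    fun u => ?_⟩
  change _ = piFun k p e b (toricIncl k σ (toricBasis k σ u))
  rw [hφ, toricIncl_toricBasis]
  by_cases h : ∃ w : Fin d → ℤ, p ^ e • w = b + u
  · obtain ⟨w, hw⟩ := h
    have h1 := piFun_single k p e b w 1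
    rw [sub_eq_of_eq_add' hw, map_one] at h1
    rw [hg1 u ⟨w, hb u u.2 w hw⟩ hw, toricIncl_toricBasis, h1]
  · push Not at h
    rw [hg2 u h, map_zero, piFun_single_of_ne]
    intro w hw
    refine h w ?_
    rw [hw]
    abel

end

/-- The degrees `b` (scaled by `q`) in which a Cartier map `φ` of the toric ring has a nonzero
component: `x ^ w` occurs in `φ((x ^ u) ^ {1/q})` for some `u`, `w` with `b = q w - u`. -/
def degreeSupport {k : Type*} [Field k] {p e d : ℕ} [ExpChar k p]
    {σ : PointedCone ℝ (Fin d → ℝ)} (φ : Cartier p e (ToricRing k σ)) : Set (Fin d → ℤ) :=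
  {b | ∃ u w : dualMonoid σ, p ^ e • (w : Fin d → ℤ) = b + u ∧
    (toricBasis k σ).repr (φ (root p e _ (toricBasis k σ u))) w ≠ 0}

section
variable {k : Type*} [Field k] {p e d : ℕ} [ExpChar k p]
  {σ : PointedCone ℝ (Fin d → ℝ)} (φ : Cartier p e (ToricRing k σ))

/-- The coefficient of `x ^ w` in `φ((x ^ u) ^ {1/q})` depends only on `q w - u`. -/
theorem repr_eq_of_degree_eq {u w u' w' : dualMonoid σ} {b : Fin d → ℤ}
    (h : p ^ e • (w : Fin d → ℤ) = b + u) (h' : p ^ e • (w' : Fin d → ℤ) = b + u') :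
    (toricBasis k σ).repr (φ (root p e _ (toricBasis k σ u))) w =
      (toricBasis k σ).repr (φ (root p e _ (toricBasis k σ u'))) w' := by
  have h1 : p ^ e • w' + u = p ^ e • w + u' := by
    apply Subtype.ext
    simp only [AddSubmonoid.coe_add, AddSubmonoidClass.coe_nsmul, h, h']
    abel
  rw [← repr_cartier_shift φ toricBasis_add w' u w, h1, add_comm w' w,
    repr_cartier_shift φ toricBasis_add]

variable {φ}

/-- If `b = q w - u` is a degree of `φ` and `q w' = b + u'`, then multiplying by a monomial `x ^ s`
for which `w' - w + s` lies in the dual monoid shows that `w' + s` lies in `s` plus the dual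
monoid. -/
theorem shiftPreserves_of_mem_degreeSupport (hrat : IsRationalPolyhedral σ)
    (hconv : IsStronglyConvex σ) {b : Fin d → ℤ} (hb : b ∈ degreeSupport φ) :
    ShiftPreserves (p ^ e) σ b := by
  obtain ⟨u, w, hw, hne⟩ := hb
  intro u' hu' w' hw'
  obtain ⟨s, hs, hz⟩ := exists_add_mem_dualMonoid hrat hconv (w' - w)
  obtain ⟨w'', hw''⟩ := exists_add_eq_of_repr_cartier_ne_zero φ toricBasis_add (u' := ⟨u', hu'⟩)
    (t := ⟨_, hz⟩) (s := ⟨s, hs⟩) hne (by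
      apply Subtype.ext
      simp only [AddSubmonoid.coe_add, AddSubmonoidClass.coe_nsmul, smul_add, smul_sub, hw, hw']
      abel)
  have h1 := congrArg Subtype.val hw''
  simp only [AddSubmonoid.coe_add] at h1
  have h2 : w' = w'' := by
    have : w' - w + s + w = w' + s := by abel
    rw [this, add_comm s] at h1
    exact add_right_cancel h1
  rw [h2]
  exact w''.2

/-- Every residue class of the lattice modulo `q` meets the dual monoid. -/
theorem exists_dualMonoid_residue (hrat : IsRationalPolyhedral σ) (hconv : IsStronglyConvex σ)
    {q : ℕ} (hq : 0 < q) (z : Fin d → ℤ) :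
    ∃ u : dualMonoid σ, ∃ t : Fin d → ℤ, (u : Fin d → ℤ) = z + q • t := by
  obtain ⟨t, ht, hzt⟩ := exists_add_mem_dualMonoid hrat hconv z
  refine ⟨⟨z + q • t, ?_⟩, t, rfl⟩
  obtain ⟨r, rfl⟩ : ∃ r, q = r + 1 := ⟨q - 1, by omega⟩
  rw [succ_nsmul', ← add_assoc]
  exact add_mem hzt (nsmul_mem ht r)

theorem exists_residue_eq_add {q : ℕ} (z : Fin d → ℤ) :
    ∃ t : Fin d → ℤ, z = (fun j => z j % (q : ℤ)) + q • t := by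
  refine ⟨fun j => z j / q, funext fun j => ?_⟩
  simp [Int.emod_add_mul_ediv]

/-- Finitely many monomials represent all residue classes modulo `q`, and `φ` is determined by its
values on their roots. -/
theorem finite_degreeSupport (hrat : IsRationalPolyhedral σ) (hconv : IsStronglyConvex σ)
    (hp : 0 < p) : (degreeSupport φ).Finite := by
  have hq : 0 < p ^ e := pow_pos hp e
  choose f t hf using exists_dualMonoid_residue hrat hconv hq
  let Z : Set (Fin d → ℤ) := Set.Icc (fun _ => 0) (fun _ => ((p ^ e : ℕ) : ℤ))
  have hZ : Z.Finite := Set.finite_Icc _ _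
  refine (hZ.biUnion fun z _ => ((((toricBasis k σ).repr (φ (root p e _
    (toricBasis k σ (f z))))).support.finite_toSet).image
      fun w : dualMonoid σ => p ^ e • (w : Fin d → ℤ) - f z)).subset ?_
  intro b hb
  have hpres := shiftPreserves_of_mem_degreeSupport hrat hconv hb
  obtain ⟨u, w, hw, hne⟩ := hb
  obtain ⟨s, hs⟩ := exists_residue_eq_add (q := p ^ e) (u : Fin d → ℤ)
  set z : Fin d → ℤ := fun j => (u : Fin d → ℤ) j % ((p ^ e : ℕ) : ℤ)
  have hw' : p ^ e • ((w : Fin d → ℤ) - s + t z) = b + f z := by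
    rw [smul_add, smul_sub, hw, hf, hs]
    abel
  have hmem := hpres _ (f z).2 _ hw'
  refine Set.mem_iUnion₂.2 ⟨z, ?_, ⟨_, hmem⟩, ?_, ?_⟩
  · have hq' : (0 : ℤ) < ((p ^ e : ℕ) : ℤ) := by exact_mod_cast hq
    exact ⟨fun j => Int.emod_nonneg _ hq'.ne', fun j => (Int.emod_lt_of_pos _ hq').le⟩
  · rw [Finset.mem_coe, Finsupp.mem_support_iff,
      repr_eq_of_degree_eq φ (w := ⟨_, hmem⟩) hw' hw]
    exact hne
  · change p ^ e • ((w : Fin d → ℤ) - s + t z) - f z = b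
    rw [hw']
    abel

/-- A Cartier map of the toric ring is a linear combination of the maps `π_a` in its support. -/
theorem mem_span_isRestriction [PerfectRing k p] [NeZero p] (hrat : IsRationalPolyhedral σ)
    (hconv : IsStronglyConvex σ) (φ : Cartier p e (ToricRing k σ)) :
    φ ∈ Submodule.span k {ψ : Cartier p e (ToricRing k σ) |
      ∃ b ∈ degreeSupport φ, IsRestriction k p e σ ψ (piMap k p e b)} := by
  classical
  have hfin := finite_degreeSupport (φ := φ) hrat hconv (NeZero.pos p)
  have hex : ∀ b : degreeSupport φ, ∃ ψ : Cartier p e (ToricRing k σ),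
      IsRestriction k p e σ ψ (piMap k p e b) := fun b =>
    (shiftPreserves_of_mem_degreeSupport hrat hconv b.2).exists_isRestriction
  choose Ψ hΨ using hex
  have hc : ∀ b : degreeSupport φ, ∃ c : k, ∀ u w : dualMonoid σ,
      p ^ e • (w : Fin d → ℤ) = b + u →
      (toricBasis k σ).repr (φ (root p e _ (toricBasis k σ u))) w = c := by
    rintro ⟨b, u, w, hw, -⟩
    exact ⟨_, fun u' w' hw' => repr_eq_of_degree_eq φ hw' hw⟩
  choose c hc using hc
  have : Fintype (degreeSupport φ) := hfin.fintype
  have hsum : φ = ∑ b : degreeSupport φ, c b • Ψ b := by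
    refine cartier_ext_of_basis p e (toricBasis k σ) fun u => ?_
    apply (toricBasis k σ).repr.injective
    ext w
    rw [LinearMap.sum_apply, map_sum, Finsupp.finsetSum_apply]
    have hterm : ∀ b : degreeSupport φ,
        (toricBasis k σ).repr ((c b • Ψ b) (root p e _ (toricBasis k σ u))) w =
          if p ^ e • (w : Fin d → ℤ) - u = b then c b else 0 := by
      intro b
      rw [LinearMap.smul_apply, map_smul, Finsupp.smul_apply, smul_eq_mul]
      split_ifs with h
      · rw [(hΨ b).apply_of_eq (w := w) (by rw [← h]; abel), Module.Basis.repr_self,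
          Finsupp.single_eq_same, mul_one]
      · by_cases h' : ∃ w' : Fin d → ℤ, p ^ e • w' = b + u
        · obtain ⟨w', hw'⟩ := h'
          have hmem := shiftPreserves_of_mem_degreeSupport hrat hconv b.2 u u.2 w' hw'
          rw [(hΨ b).apply_of_eq (w := ⟨w', hmem⟩) hw', Module.Basis.repr_self,
            Finsupp.single_eq_of_ne, mul_zero]
          rintro rfl
          exact h (sub_eq_of_eq_add hw')
        · push Not at h'
          rw [(hΨ b).apply_of_ne h', map_zero, Finsupp.zero_apply, mul_zero]
    rw [Finset.sum_congr rfl fun b _ => hterm b]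
    have hdeg : p ^ e • (w : Fin d → ℤ) = p ^ e • (w : Fin d → ℤ) - u + u := by abel
    by_cases hb : p ^ e • (w : Fin d → ℤ) - u ∈ degreeSupport φ
    · rw [Finset.sum_eq_single ⟨_, hb⟩]
      · rw [if_pos rfl]
        exact hc ⟨_, hb⟩ u w hdeg
      · intro b _ hne
        exact if_neg fun h => hne (Subtype.ext h.symm)
      · exact fun h => absurd (Finset.mem_univ _) h
    · rw [Finset.sum_eq_zero]
      · by_contra hne
        exact hb ⟨u, w, hdeg, hne⟩
      · rintro ⟨b, hb'⟩ _
        exact if_neg fun h => hb (by rw [h]; exact hb')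
  rw [hsum]
  refine Submodule.sum_mem _ fun b _ => Submodule.smul_mem _ _ (Submodule.subset_span ?_)
  rw [← hsum]
  exact ⟨b, b.2, hΨ b⟩

end

/-! ### The tensor power of a toric ring -/

/-- The basis of pure tensors of monomials of the `n`-fold tensor power of the toric ring. -/
noncomputable def tensorBasis (k : Type*) [Field k] (n : ℕ) {d : ℕ}
    (σ : PointedCone ℝ (Fin d → ℝ)) :
    Module.Basis (Fin n → dualMonoid σ) k (TensorPow k n (ToricRing k σ)) :=
  Basis.piTensorProduct fun _ => toricBasis k σ

section
variable {k : Type*} [Field k] {n d : ℕ} {σ : PointedCone ℝ (Fin d → ℝ)}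

theorem tensorBasis_add (m m' : Fin n → dualMonoid σ) :
    tensorBasis k n σ (m + m') = tensorBasis k n σ m * tensorBasis k n σ m' := by
  simp only [tensorBasis, Basis.piTensorProduct_apply, PiTensorProduct.tprod_mul_tprod]
  congr 1
  funext i
  exact toricBasis_add _ _

theorem prod_toricBasis (m : Fin n → dualMonoid σ) :
    ∏ i, toricBasis k σ (m i) = toricBasis k σ (∑ i, m i) := by
  classical
  induction (Finset.univ : Finset (Fin n)) using Finset.induction_on with
  | empty => simp [multiplicative_basis_zero (β := toricBasis k σ) toricBasis_add]
  | insert i s hi ih => rw [Finset.prod_insert hi, Finset.sum_insert hi, toricBasis_add, ih]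

theorem diagMap_tensorBasis (m : Fin n → dualMonoid σ) :
    diagMap k n (ToricRing k σ) (tensorBasis k n σ m) = toricBasis k σ (∑ i, m i) := by
  rw [tensorBasis, Basis.piTensorProduct_apply, diagMap_tprod, prod_toricBasis]

/-- A monomial occurring in `Δ_n(x)` is the product of the factors of a pure tensor of monomials
occurring in `x`. -/
theorem exists_repr_tensorBasis_ne_zero {x : TensorPow k n (ToricRing k σ)} {w : dualMonoid σ}
    (h : (toricBasis k σ).repr (diagMap k n (ToricRing k σ) x) w ≠ 0) :
    ∃ m : Fin n → dualMonoid σ, (tensorBasis k n σ).repr x m ≠ 0 ∧ ∑ i, m i = w := by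
  by_contra! hcon
  apply h
  conv_lhs => rw [← (tensorBasis k n σ).linearCombination_repr x]
  rw [Finsupp.linearCombination_apply, Finsupp.sum, map_sum, map_sum, Finsupp.finsetSum_apply]
  refine Finset.sum_eq_zero fun m hm => ?_
  rw [map_smul, map_smul, diagMap_tensorBasis, Module.Basis.repr_self, Finsupp.smul_apply,
    Finsupp.single_eq_of_ne (hcon m (Finsupp.mem_support_iff.1 hm)).symm, smul_zero]

end

/-! ### The diagonal condition -/

/-- The diagonal condition in terms of integral vectors: everything is scaled by `q`, and
membership in the interior of the anticanonical polytope is replaced by `ShiftPreserves`. -/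
theorem diagCondition_succ_iff {d : ℕ} {σ : PointedCone ℝ (Fin d → ℝ)}
    (hrat : IsRationalPolyhedral σ) (hconv : IsStronglyConvex σ) (p N e : ℕ) [NeZero p]
    (b : Fin d → ℤ) : DiagCondition p (N + 1) e σ (frac p e b) ↔
      ∀ U : Fin N → Fin d → ℤ, ∃ B : Fin N → Fin d → ℤ,
        (∀ i, ∃ m : Fin d → ℤ, B i = U i + p ^ e • m) ∧
        (∀ i, ShiftPreserves (p ^ e) σ (B i)) ∧ ShiftPreserves (p ^ e) σ (b - ∑ i, B i) := by
  have hp : ((p : ℝ) ^ e) ≠ 0 := pow_ne_zero _ (by exact_mod_cast NeZero.ne p)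
  have hadd : ∀ u m : Fin d → ℤ, frac p e (u + p ^ e • m) = frac p e u + toReal m := by
    intro u m
    funext j
    simp only [frac, toReal, Pi.add_apply, Pi.smul_apply]
    rw [nsmul_eq_mul]
    push_cast
    field_simp
  have hsub : ∀ B : Fin N → Fin d → ℤ,
      frac p e (b - ∑ i, B i) = frac p e b - ∑ i, frac p e (B i) := by
    intro B
    funext j
    simp [frac, sub_div, Finset.sum_div]
  simp only [← frac_mem_interior_iff hrat hconv]
  constructor
  · intro h U
    obtain ⟨v, hv, hint, w, hw, hsum⟩ := h U
    choose m hm using hv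
    have hv' : ∀ i, frac p e (U i + p ^ e • m i) = v i := fun i => (hadd _ _).trans (hm i).symm
    refine ⟨fun i => U i + p ^ e • m i, fun i => ⟨m i, rfl⟩, fun i => ?_, ?_⟩
    · rw [hv']
      exact hint i
    · rw [hsub, Finset.sum_congr rfl fun i _ => hv' i]
      have : frac p e b - ∑ i, v i = w := by
        rw [show ∑ i, v i = frac p e b - w from hsum]
        abel
      rw [this]
      exact hw
  · intro h U
    obtain ⟨B, hB, hint, hlast⟩ := h U
    refine ⟨fun i => frac p e (B i), fun i => ?_, hint, _, hlast, ?_⟩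
    · obtain ⟨m, hm⟩ := hB i
      exact ⟨m, (congrArg (frac p e) hm).trans (hadd _ _)⟩
    · rw [hsub]
      exact (sub_sub_cancel _ _).symm

section
variable {k : Type*} [Field k] {p e d N : ℕ} [ExpChar k p] [NeZero p]
  {σ : PointedCone ℝ (Fin d → ℝ)}

/-- If `φ` has a lifting `φ'`, the degrees of `φ` satisfy the diagonal condition: a prescribed
system of residues is realised by a pure tensor of monomials, and a term of the value of `φ'` on
its root that contributes to `φ` splits the degree `b`. -/
theorem exists_split_of_mem_degreeSupport (hrat : IsRationalPolyhedral σ)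
    (hconv : IsStronglyConvex σ) {φ : Cartier p e (ToricRing k σ)}
    (hφ : φ ∈ diagCartier k p (N + 1) e (ToricRing k σ)) {b : Fin d → ℤ}
    (hb : b ∈ degreeSupport φ) (U : Fin N → Fin d → ℤ) : ∃ B : Fin N → Fin d → ℤ,
      (∀ i, ∃ m : Fin d → ℤ, B i = U i + p ^ e • m) ∧
      (∀ i, ShiftPreserves (p ^ e) σ (B i)) ∧ ShiftPreserves (p ^ e) σ (b - ∑ i, B i) := by
  have hq : 0 < p ^ e := pow_pos (NeZero.pos p) e
  obtain ⟨φ', hφ'⟩ := hφ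
  -- `W` has residues `-U` in the first `N` places and total residue `-b`
  choose W t hW using fun i : Fin (N + 1) => exists_dualMonoid_residue (σ := σ) hrat hconv hq
    (Fin.snoc (α := fun _ => Fin d → ℤ) (fun j => -U j) (-(b - ∑ j, U j)) i)
  have hsumW : ((∑ i, W i : dualMonoid σ) : Fin d → ℤ) = -b + p ^ e • ∑ i, t i := by
    rw [AddSubmonoid.coe_finsetSum, Finset.sum_congr rfl fun i _ => hW i, Finset.sum_add_distrib,
      Finset.smul_sum, Fin.sum_univ_castSucc]
    simp only [Fin.snoc_castSucc, Fin.snoc_last, Finset.sum_neg_distrib]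
    abel
  have hw : p ^ e • (∑ i, t i) = b + (∑ i, W i : dualMonoid σ) := by rw [hsumW]; abel
  have hmem := shiftPreserves_of_mem_degreeSupport hrat hconv hb _ (∑ i, W i).2 _ hw
  have hne : (toricBasis k σ).repr (φ (root p e _ (toricBasis k σ (∑ i, W i)))) ⟨_, hmem⟩ ≠ 0 := by
    obtain ⟨u', w', hw', hne⟩ := hb
    rwa [repr_eq_of_degree_eq φ (w := ⟨_, hmem⟩) hw hw']
  have hlift := hφ' (root p e _ (tensorBasis k (N + 1) σ W))
  have hmap : FrobRoot.map p e (diagMap k (N + 1) (ToricRing k σ)).toRingHom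
      (root p e _ (tensorBasis k (N + 1) σ W)) = root p e _ (toricBasis k σ (∑ i, W i)) :=
    congrArg (root p e (ToricRing k σ)) (diagMap_tensorBasis W)
  rw [hmap] at hlift
  rw [← hlift] at hne
  obtain ⟨V, hV, hVsum⟩ := exists_repr_tensorBasis_ne_zero hne
  have hVsum' : ∑ i, (V i : Fin d → ℤ) = ∑ i, t i := by
    rw [← AddSubmonoid.coe_finsetSum, hVsum]
  have hpres : ∀ i, ShiftPreserves (p ^ e) σ (p ^ e • (V i : Fin d → ℤ) - W i) := by
    intro i u' hu' w' hw'
    obtain ⟨s, hs, hz⟩ := exists_add_mem_dualMonoid hrat hconv (w' - V i)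
    obtain ⟨V', hV'⟩ := exists_add_eq_of_repr_cartier_ne_zero φ' tensorBasis_add
      (u' := Function.update W i ⟨u', hu'⟩) (t := Function.update 0 i ⟨_, hz⟩)
      (s := Function.update 0 i ⟨s, hs⟩) hV (by
        funext j
        by_cases hj : j = i
        · subst hj
          apply Subtype.ext
          simp only [Pi.add_apply, Pi.smul_apply, Function.update_self, AddSubmonoid.coe_add,
            AddSubmonoidClass.coe_nsmul, smul_add, smul_sub, hw']
          abel
        · simp only [Pi.add_apply, Pi.smul_apply, Function.update_of_ne hj])
    have h1 := congrArg Subtype.val (congrFun hV' i)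
    simp only [Pi.add_apply, Function.update_self, AddSubmonoid.coe_add] at h1
    have h2 : w' = V' i := by
      have : w' - V i + s + V i = w' + s := by abel
      rw [this, add_comm s] at h1
      exact add_right_cancel h1
    rw [h2]
    exact (V' i).2
  refine ⟨fun i => p ^ e • (V i.castSucc : Fin d → ℤ) - W i.castSucc, fun i =>
    ⟨V i.castSucc - t i.castSucc, ?_⟩, fun i => hpres _, ?_⟩
  · change p ^ e • (V i.castSucc : Fin d → ℤ) - W i.castSucc = _
    rw [hW, Fin.snoc_castSucc, smul_sub]
    abel
  · have h1 : b - ∑ i : Fin N, (p ^ e • (V i.castSucc : Fin d → ℤ) - W i.castSucc) =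
        p ^ e • (V (Fin.last N) : Fin d → ℤ) - W (Fin.last N) := by
      have h2 : ∑ i : Fin (N + 1), (p ^ e • (V i : Fin d → ℤ) - W i) = b := by
        rw [Finset.sum_sub_distrib, ← Finset.smul_sum, hVsum', ← AddSubmonoid.coe_finsetSum, hw]
        abel
      rw [Fin.sum_univ_castSucc] at h2
      rw [← h2]
      abel
    rw [h1]
    exact hpres _

/-- If `b` satisfies the diagonal condition, `π_a` with `a = b / q` has a lifting: choose a
splitting of `b` for every system of residues, and let the lifting act on a pure tensor of
monomials by the splitting that belongs to the negatives of its residues. -/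
theorem mem_diagCartier_of_split [PerfectRing k p] {φ : Cartier p e (ToricRing k σ)} {b : Fin d → ℤ}
    (hφ : IsRestriction k p e σ φ (piMap k p e b))
    (hsplit : ∀ U : Fin N → Fin d → ℤ, ∃ B : Fin N → Fin d → ℤ,
      (∀ i, ∃ m : Fin d → ℤ, B i = U i + p ^ e • m) ∧
      (∀ i, ShiftPreserves (p ^ e) σ (B i)) ∧ ShiftPreserves (p ^ e) σ (b - ∑ i, B i)) :
    φ ∈ diagCartier k p (N + 1) e (ToricRing k σ) := by
  classical
  have hq : 0 < p ^ e := pow_pos (NeZero.pos p) e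
  choose B hB hpres hlast using hsplit
  -- the splitting depends on the residues only, so that the lifting is linear
  let res : (Fin (N + 1) → dualMonoid σ) → Fin N → Fin d → ℤ :=
    fun W i j => (-(W i.castSucc : Fin d → ℤ)) j % ((p ^ e : ℕ) : ℤ)
  let C : (Fin (N + 1) → dualMonoid σ) → Fin (N + 1) → Fin d → ℤ := fun W =>
    Fin.snoc (α := fun _ => Fin d → ℤ) (B (res W)) (b - ∑ i, B (res W) i)
  have hC : ∀ W i, ShiftPreserves (p ^ e) σ (C W i) := by
    intro W i
    refine Fin.lastCases ?_ (fun i => ?_) i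
    · simp only [C, Fin.snoc_last]
      exact hlast _
    · simp only [C, Fin.snoc_castSucc]
      exact hpres _ _
  have hCsum : ∀ W, ∑ i, C W i = b := by
    intro W
    rw [Fin.sum_univ_castSucc]
    simp only [C, Fin.snoc_castSucc, Fin.snoc_last]
    abel
  have hCadd : ∀ T W, C (p ^ e • T + W) = C W := by
    intro T W
    have : res (p ^ e • T + W) = res W := by
      funext i j
      simp only [res, Pi.add_apply, Pi.smul_apply, Pi.neg_apply, AddSubmonoid.coe_add,
        AddSubmonoidClass.coe_nsmul]
      rw [nsmul_eq_mul, neg_add, add_comm, ← mul_neg]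
      exact Int.add_mul_emod_self_left _ _ _
    simp only [C, this]
  have hres : ∀ W (i : Fin N), ∃ m : Fin d → ℤ, C W i.castSucc + W i.castSucc = p ^ e • m := by
    intro W i
    obtain ⟨m, hm⟩ := hB (res W) i
    obtain ⟨s, hs⟩ := exists_residue_eq_add (q := p ^ e) (-(W i.castSucc : Fin d → ℤ))
    refine ⟨m - s, ?_⟩
    have h1 : (W i.castSucc : Fin d → ℤ) = -(res W i + p ^ e • s) :=
      (neg_eq_iff_eq_neg.1 hs)
    simp only [C, Fin.snoc_castSucc]
    rw [hm, h1, smul_sub]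
    abel
  let g : (Fin (N + 1) → dualMonoid σ) → TensorPow k (N + 1) (ToricRing k σ) := fun W =>
    if h : ∃ V : Fin (N + 1) → dualMonoid σ, ∀ i, p ^ e • (V i : Fin d → ℤ) = C W i + W i then
      tensorBasis k (N + 1) σ h.choose else 0
  have hg1 : ∀ W V : Fin (N + 1) → dualMonoid σ,
      (∀ i, p ^ e • (V i : Fin d → ℤ) = C W i + W i) → g W = tensorBasis k (N + 1) σ V := by
    intro W V hV
    have h : ∃ V : Fin (N + 1) → dualMonoid σ, ∀ i, p ^ e • (V i : Fin d → ℤ) = C W i + W i :=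
      ⟨V, hV⟩
    have h2 : h.choose = V := funext fun i => Subtype.ext
      (nsmul_left_cancel hq ((h.choose_spec i).trans (hV i).symm))
    simp only [g, dif_pos h, h2]
  have hg2 : ∀ W : Fin (N + 1) → dualMonoid σ,
      (¬ ∃ V : Fin (N + 1) → dualMonoid σ, ∀ i, p ^ e • (V i : Fin d → ℤ) = C W i + W i) →
      g W = 0 := fun W h => dif_neg h
  obtain ⟨φ', hφ'⟩ := exists_cartier_of_basis p e (β := tensorBasis k (N + 1) σ)
    tensorBasis_add g (by
    intro T W
    by_cases h : ∃ V : Fin (N + 1) → dualMonoid σ, ∀ i, p ^ e • (V i : Fin d → ℤ) = C W i + W i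
    · obtain ⟨V, hV⟩ := h
      rw [hg1 W V hV, ← tensorBasis_add, hg1]
      intro i
      rw [hCadd]
      simp only [Pi.add_apply, Pi.smul_apply, AddSubmonoid.coe_add, AddSubmonoidClass.coe_nsmul,
        smul_add, hV i]
      abel
    · rw [hg2 W h, mul_zero, hg2]
      rintro ⟨V, hV⟩
      have hV' : ∀ i, p ^ e • ((V i : Fin d → ℤ) - T i) = C W i + W i := by
        intro i
        have := hV i
        rw [hCadd] at this
        rw [smul_sub, this]
        simp only [Pi.add_apply, Pi.smul_apply, AddSubmonoid.coe_add, AddSubmonoidClass.coe_nsmul]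
        abel
      exact h ⟨fun i => ⟨_, hC W i _ (W i).2 _ (hV' i)⟩, hV'⟩)
  refine ⟨φ', cartier_comm_of_basis p e (tensorBasis k (N + 1) σ)
    (diagMap k (N + 1) (ToricRing k σ)).toRingHom
    (fun c => (diagMap k (N + 1) (ToricRing k σ)).commutes c) φ' φ fun W => ?_⟩
  change diagMap k (N + 1) (ToricRing k σ) _ =
    φ (root p e _ (diagMap k (N + 1) (ToricRing k σ) (tensorBasis k (N + 1) σ W)))
  rw [hφ', diagMap_tensorBasis]
  have hsum : ∑ i, (C W i + W i) = b + (∑ i, W i : dualMonoid σ) := by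
    rw [Finset.sum_add_distrib, hCsum, AddSubmonoid.coe_finsetSum]
  by_cases h : ∃ V : Fin (N + 1) → dualMonoid σ, ∀ i, p ^ e • (V i : Fin d → ℤ) = C W i + W i
  · obtain ⟨V, hV⟩ := h
    rw [hg1 W V hV, diagMap_tensorBasis]
    refine (hφ.apply_of_eq ?_).symm
    rw [← hsum, AddSubmonoid.coe_finsetSum, Finset.smul_sum]
    exact Finset.sum_congr rfl fun i _ => hV i
  · rw [hg2 W h, map_zero]
    refine (hφ.apply_of_ne fun w hw => h ?_).symm
    -- all but the last of the `C W i + W i` are divisible by `q`, and so is their sum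
    choose m hm using hres W
    have hlast' : C W (Fin.last N) + W (Fin.last N) = p ^ e • (w - ∑ i, m i) := by
      rw [← hw, Fin.sum_univ_castSucc, Finset.sum_congr rfl fun i _ => hm i] at hsum
      rw [smul_sub, ← hsum, Finset.smul_sum]
      abel
    have hall : ∀ i, ∃ v : Fin d → ℤ, p ^ e • v = C W i + W i := by
      intro i
      refine Fin.lastCases ⟨_, hlast'.symm⟩ (fun i => ⟨_, (hm i).symm⟩) i
    choose v hv using hall
    exact ⟨fun i => ⟨v i, hC W i _ (W i).2 _ (hv i)⟩, hv⟩

end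

end ToricDiag

theorem mainTheorem7 (k : Type*) [Field k] [PerfectField k] (p : ℕ) [Fact p.Prime] [CharP k p]
    (d : ℕ) (σ : PointedCone ℝ (Fin d → ℝ)) (hrat : ToricDiag.IsRationalPolyhedral σ)
    (hconv : ToricDiag.IsStronglyConvex σ) (n e : ℕ) (hn : 0 < n) (he : 0 < e) :
    ToricDiag.diagCartier k p n e (ToricDiag.ToricRing k σ) =
      Submodule.span k {φ : ToricDiag.Cartier p e (ToricDiag.ToricRing k σ) |
        ∃ b : Fin d → ℤ, ToricDiag.IsRestriction k p e σ φ (ToricDiag.piMap k p e b) ∧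
          ToricDiag.DiagCondition p n e σ (ToricDiag.frac p e b)} := by
  obtain ⟨N, rfl⟩ : ∃ N, n = N + 1 := ⟨n - 1, by omega⟩
  apply le_antisymm
  · intro φ hφ
    refine Submodule.span_mono ?_ (ToricDiag.mem_span_isRestriction hrat hconv φ)
    rintro ψ ⟨b, hb, hψ⟩
    exact ⟨b, hψ, (ToricDiag.diagCondition_succ_iff hrat hconv p N e b).2
      (ToricDiag.exists_split_of_mem_degreeSupport hrat hconv hφ hb)⟩
  · refine Submodule.span_le.2 ?_
    rintro φ ⟨b, hφ, hb⟩
    exact ToricDiag.mem_diagCartier_of_split hφ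
      ((ToricDiag.diagCondition_succ_iff hrat hconv p N e b).1 hb)
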